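/- Let $K$ be a commutative ring, $\iota\colon B\to A$ a homomorphism of unital $K$-algebras (an algebra extension $A\,\|\,B$), $R=C_A(B)$ the centralizer of $B$ in $A$, $Z(A)$ the centre of $A$, $\mathrm{Aut}_B(A)$ the group of $K$-algebra automorphisms of $A$ fixing $B$ elementwise, and $\mathcal S=\mathrm{End}({}_BA_B)$ the algebra of $B$-bimodule endomorphisms of $A$. Write $\lambda_r,\rho_r$ for left and right multiplication by $r\in R$. A left depth two quasibasis is a finite family $\beta_i\in\mathcal S$, $t_i=t_i^1\otimes t_i^2\in(A\otimes_BA)^B$ with $\sum_i t_i\,\beta_i(x)y=x\otimes_B y$ for all $x,y\in A$. Given one, $\mathcal S$ carries the structure of source map $\lambda$, target map $\rho$, counit $\varepsilon(\alpha)=\alpha(1)$ and coproduct $\Delta(\alpha)=\sum_i\alpha(?\,t_i^1)t_i^2\otimes_R\beta_i$. For a commutative ring $k$ over which $R$ is an algebra, $R\otimes_kR^{op}$ carries the source map $r\mapsto r\otimes\overline 1$, the target map $r\mapsto1\otimes\overline r$, $\Delta(r\otimes\overline s)=(r\otimes\overline 1)\otimes_R(1\otimes\overline s)$, $\varepsilon(r\otimes\overline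 s)=rs$ and the twist $\tau(r\otimes\overline s)=s\otimes\overline r$. For a subgroup $G\le\mathrm{Aut}_B(A)$ (which acts on $R$), $R^e\bowtie G$ is the $K$-module $R\otimes_KR^{op}\otimes_KK[G]$ with product $(r\otimes\overline s\bowtie\sigma)(u\otimes\overline v\bowtie\tau)=r\sigma(u)\otimes\overline{v\tau^{-1}(s)}\bowtie\sigma\tau$, source $r\mapsto r\otimes\overline1\bowtie e$, target $r\mapsto1\otimes\overline r\bowtie e$, $\varepsilon(r\otimes\overline s\bowtie\sigma)=r\sigma(s)$ and $\Delta(r\otimes\overline s\bowtie\sigma)=(r\otimes\overline1\bowtie\sigma)\otimes_R(1\otimes\overline s\bowtie\sigma)$. A finite set $\mathcal G\subseteq\mathrm{Aut}_B(A)$ is a pseudo-Galois set if $A\otimes_BA$ is isomorphic, as an $A$-$A$-bimodule, to a direct summand of $\bigoplus_{\sigma\in\mathcal G}A_\sigma^N$ for some $N\ge1$ (where $x\cdot a\cdot y=xa\sigma(y)$ in $A_\sigma$); it is called minimal if no proper subset is one and $A_\sigma\not\cong A_\tau$ for $\sigma\ne\tau$ in $\mathcal G$. (1) Suppose $A\,\|\,B$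 is H-separable, i.e. $A\otimes_BA$ is isomorphic to a direct summand of $A^N$ as an $A$-$A$-bimodule for some $N\ge1$. Then $\mathcal G=\{\mathrm{id}_A\}$ is a pseudo-Galois set (a minimal one if $A\neq0$), the group $G$ it generates is trivial, and it is the only minimal pseudo-Galois set that contains $\mathrm{id}_A$. A left depth two quasibasis exists. For each of them, $\mathcal S$ and $R^e:=R\otimes_{Z(A)}R^{op}$ are left $R$-bialgebroids, $\tau$ is an antipode of $R^e$, the map $\Psi\colon R^e\to\mathcal S$, $\Psi(r\otimes\overline s)=\lambda_r\circ\rho_s$, is an isomorphism of $R$-bialgebroids, and $\Psi\circ\tau\circ\Psi^{-1}$ is an antipode of $\mathcal S$ (an antipode being an anti-automorphism $\tau$ with $\tau\circ t=s$ for the source $s$ and the target $t$, $\tau^{-1}(c_{(2)})_{(1)}\otimes\tau^{-1}(c_{(2)})_{(2)}c_{(1)}=\tau^{-1}(c)\otimes1$ and $\tau(c_{(1)})_{(1)}c_{(2)}\otimes\tau(c_{(1)})_{(2)}=1\otimes\tau(c)$). If $K$ maps onto $Z(A)$, the same holds with $R^e=R\otimes_KR^{op}$. (2) Suppose $A\,\|\,B$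 is $G$-Galois: $G$ is a finite group of automorphisms of $A$, $\iota$ is injective with image $A^G$, and there are $a_i,b_i\in A$ ($1\le i\le n$) with $\sum_ia_ib_i=1$ and $\sum_ia_i\sigma(b_i)=0$ for $\mathrm{id}\neq\sigma\in G$. Then a left depth two quasibasis exists, and for each of them $\mathcal S$ and $R^e\bowtie G$ are left $R$-bialgebroids and $\Psi\colon R^e\bowtie G\to\mathcal S$, $\Psi(r\otimes\overline s\bowtie\sigma)=\lambda_r\circ\sigma\circ\rho_s$, is a surjective homomorphism of $R$-bialgebroids. There is an isomorphism of algebras $\Phi\colon\mathcal S\to R\rtimes G$, $\Phi(\alpha)=\sum_{\sigma\in G}\sum_i\alpha(a_i)\sigma(b_i)\,\sigma$ (for any such $a_i,b_i$), with inverse $r\sigma\mapsto\lambda_r\circ\sigma$, and $\Psi$ is split as an epimorphism of algebras: $j\colon R\rtimes G\to R^e\bowtie G$, $j(r\sigma)=r\otimes\overline1\bowtie\sigma$, is an algebra homomorphism with $\Phi\circ\Psi\circ j=\mathrm{id}$ and $\Psi\circ j\circ\Phi=\mathrm{id}$. -/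

import Mathlib

open scoped TensorProduct
open MulOpposite (op unop)

noncomputable section

/-! Balanced tensor products over a noncommutative ring. -/

section Balanced

/-- The balanced tensor product `M ⊗_R N` of a right `R`-module `M` (action `actR`) and a left
`R`-module `N` (action `actL`): the quotient of `M ⊗_ℤ N` by all `(m · r) ⊗ n - m ⊗ (r · n)`. -/
def BalTens {R M N : Type*} [AddCommGroup M] [AddCommGroup N]
    (actR : R → M → M) (actL : R → N → N) :=
  (M ⊗[ℤ] N) ⧸ AddSubgroup.closure
    {x : M ⊗[ℤ] N | ∃ (r : R) (m : M) (n : N), x = actR r m ⊗ₜ[ℤ] n - m ⊗ₜ[ℤ] actL r n}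

namespace BalTens

variable {R M N P : Type*} [AddCommGroup M] [AddCommGroup N] [AddCommGroup P]
  {actR : R → M → M} {actL : R → N → N}

instance : AddCommGroup (BalTens actR actL) :=
  inferInstanceAs (AddCommGroup ((M ⊗[ℤ] N) ⧸ AddSubgroup.closure
    {x : M ⊗[ℤ] N | ∃ (r : R) (m : M) (n : N), x = actR r m ⊗ₜ[ℤ] n - m ⊗ₜ[ℤ] actL r n}))

/-- The quotient map. -/
def proj (actR : R → M → M) (actL : R → N → N) : (M ⊗[ℤ] N) →+ BalTens actR actL :=
  QuotientAddGroup.mk' _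

/-- The class of the pure tensor `m ⊗ n`, as a biadditive map. -/
def tmul (actR : R → M → M) (actL : R → N → N) : M →+ N →+ BalTens actR actL :=
  AddMonoidHom.mk' (fun m => AddMonoidHom.mk' (fun n => proj actR actL (m ⊗ₜ[ℤ] n))
      (fun n n' => by rw [TensorProduct.tmul_add, map_add]))
    (fun m m' => by
      ext n
      change proj actR actL ((m + m') ⊗ₜ[ℤ] n) = _
      rw [TensorProduct.add_tmul, map_add]; rfl)

theorem tmul_balanced (r : R) (m : M) (n : N) :
    tmul actR actL (actR r m) n = tmul actR actL m (actL r n) := by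
  refine (QuotientAddGroup.eq_iff_sub_mem).2 (AddSubgroup.subset_closure ⟨r, m, n, rfl⟩)

/-- The universal property: a balanced biadditive map factors through `M ⊗_R N`. -/
def lift (f : M →+ N →+ P) (hf : ∀ r m n, f (actR r m) n = f m (actL r n)) :
    BalTens actR actL →+ P :=
  QuotientAddGroup.lift _
    (TensorProduct.liftAddHom f (fun z m n => by simp) : M ⊗[ℤ] N →+ P) <| by
      rw [AddSubgroup.closure_le]
      rintro _ ⟨r, m, n, rfl⟩
      simp [hf]

@[simp] theorem lift_tmul (f : M →+ N →+ P) (hf : ∀ r m n, f (actR r m) n = f m (actL r n))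
    (m : M) (n : N) : lift f hf (tmul actR actL m n) = f m n := rfl

@[elab_as_elim] theorem induction_on {p : BalTens actR actL → Prop} (w : BalTens actR actL)
    (zero : p 0) (tmul : ∀ m n, p (tmul actR actL m n)) (add : ∀ v w, p v → p w → p (v + w)) :
    p w := by
  obtain ⟨w, rfl⟩ := QuotientAddGroup.mk'_surjective _ w
  change p (proj actR actL w)
  induction w with
  | zero => rwa [map_zero]
  | tmul m n => exact tmul m n
  | add v w hv hw => rw [map_add]; exact add _ _ hv hw

end BalTens

end Balanced

/-! Left bialgebroids and their antipodes. -/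

section Bialgebroids

/-- A source map `R → C` and a target map `R → C` (an anti-homomorphism) with commuting images. -/
structure SourceTarget (R C : Type*) [Ring R] [Ring C] where
  source : R →+* C
  target : Rᵐᵒᵖ →+* C
  commute : ∀ r s, source r * target s = target s * source r

namespace SourceTarget

variable {R C : Type*} [Ring R] [Ring C] (S : SourceTarget R C)

/-- `C ⊗_R C` for the bimodule structure `r · c · r' = source r * target r' * c`. -/
abbrev Tens :=
  BalTens (fun (r : R) (c : C) => S.target (op r) * c) (fun (r : R) (c : C) => S.source r * c)

/-- The element `a ⊗ b` of `C ⊗_R C`. -/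
abbrev tmul (a b : C) : S.Tens := BalTens.tmul _ _ a b

/-- The right `R`-action on `C ⊗_R C`: `(a ⊗ b) · r = a ⊗ (b · r)`. -/
def tensActR (r : R) : S.Tens →+ S.Tens :=
  BalTens.lift ((BalTens.tmul _ _).compl₂ (AddMonoidHom.mulLeft (S.target (op r)))) <| by
    intro q a b
    simp only [AddMonoidHom.compl₂_apply, AddMonoidHom.coe_mulLeft]
    rw [BalTens.tmul_balanced (actR := fun (r : R) (c : C) => S.target (op r) * c)
      (actL := fun (r : R) (c : C) => S.source r * c) q a, ← mul_assoc, ← mul_assoc, S.commute]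

/-- `C ⊗_R C ⊗_R C`, bracketed as `(C ⊗_R C) ⊗_R C`. -/
abbrev Tens₃ :=
  BalTens (fun (r : R) (w : S.Tens) => S.tensActR r w) (fun (r : R) (c : C) => S.source r * c)

/-- `w ⊗ c ∈ C ⊗_R C ⊗_R C` for `w ∈ C ⊗_R C`. -/
abbrev glueRight (w : S.Tens) (c : C) : S.Tens₃ := BalTens.tmul _ _ w c

/-- `c ⊗ w ∈ C ⊗_R C ⊗_R C` for `w ∈ C ⊗_R C`; on pure tensors, `c ⊗ (a ⊗ b) = (c ⊗ a) ⊗ b`. -/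
def glueLeft (c : C) : S.Tens →+ S.Tens₃ :=
  BalTens.lift ((BalTens.tmul _ _).comp (BalTens.tmul _ _ c)) <| by
    intro q a b
    exact BalTens.tmul_balanced (actR := fun (r : R) (w : S.Tens) => S.tensActR r w)
      (actL := fun (r : R) (c : C) => S.source r * c) q (S.tmul c a) b

/-- `(a ⊗ b, c) ↦ a c ⊗ b`. -/
def mulFst (c : C) : S.Tens →+ S.Tens :=
  BalTens.lift ((BalTens.tmul _ _).comp (AddMonoidHom.mulRight c)) <| by
    intro q a b
    simp only [AddMonoidHom.comp_apply, AddMonoidHom.mulRight_apply, mul_assoc]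
    exact BalTens.tmul_balanced _ _ _

/-- `(a ⊗ b, c) ↦ a ⊗ b c`. -/
def mulSnd (c : C) : S.Tens →+ S.Tens :=
  BalTens.lift ((BalTens.tmul _ _).compl₂ (AddMonoidHom.mulRight c)) <| by
    intro q a b
    simp only [AddMonoidHom.compl₂_apply, AddMonoidHom.mulRight_apply, mul_assoc]
    exact BalTens.tmul_balanced _ _ _

end SourceTarget

/-- The structure maps of a left `R`-bialgebroid on the ring `C` (no axioms on the coproduct and
counit; these are in `IsLeftBialgebroid`). Over a ground ring `K` of `R`, the `K`-algebra structure
of `C` is the one given by the source map. -/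
structure BialgebroidData (R C : Type*) [Ring R] [Ring C] extends SourceTarget R C where
  comul : C →+ toSourceTarget.Tens
  counit : C →+ R

namespace BialgebroidData

variable {R C C' : Type*} [Ring R] [Ring C] [Ring C']

/-- Sweedler notation: `Δ(c) = ∑ i, a i ⊗ b i`. -/
def Sweedler (D : BialgebroidData R C) (c : C) {n : ℕ} (a b : Fin n → C) : Prop :=
  D.comul c = ∑ i, D.tmul (a i) (b i)

/-- The axioms of a left `R`-bialgebroid. Each axiom that involves `Δ(c)` is required for all
presentations `Δ(c) = ∑ i, a i ⊗ b i`. -/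
structure IsLeftBialgebroid (D : BialgebroidData R C) : Prop where
  comul_source : ∀ (r : R) (c : C) {n : ℕ} (a b : Fin n → C), D.Sweedler c a b →
    D.comul (D.source r * c) = ∑ i, D.tmul (D.source r * a i) (b i)
  comul_target : ∀ (r : R) (c : C) {n : ℕ} (a b : Fin n → C), D.Sweedler c a b →
    D.comul (D.target (op r) * c) = ∑ i, D.tmul (a i) (D.target (op r) * b i)
  counit_source : ∀ (r : R) (c : C), D.counit (D.source r * c) = r * D.counit c
  counit_target : ∀ (r : R) (c : C), D.counit (D.target (op r) * c) = D.counit c * r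
  coassoc : ∀ (c : C) {n : ℕ} (a b : Fin n → C), D.Sweedler c a b →
    ∑ i, D.glueRight (D.comul (a i)) (b i) = ∑ i, D.glueLeft (a i) (D.comul (b i))
  counit_left : ∀ (c : C) {n : ℕ} (a b : Fin n → C), D.Sweedler c a b →
    ∑ i, D.source (D.counit (a i)) * b i = c
  counit_right : ∀ (c : C) {n : ℕ} (a b : Fin n → C), D.Sweedler c a b →
    ∑ i, D.target (op (D.counit (b i))) * a i = c
  counit_one : D.counit 1 = 1
  comul_one : D.comul 1 = D.tmul 1 1
  takeuchi : ∀ (r : R) (c : C) {n : ℕ} (a b : Fin n → C), D.Sweedler c a b →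
    ∑ i, D.tmul (a i * D.target (op r)) (b i) = ∑ i, D.tmul (a i) (b i * D.source r)
  comul_mul : ∀ (c d : C) {n m : ℕ} (a b : Fin n → C) (a' b' : Fin m → C),
    D.Sweedler c a b → D.Sweedler d a' b' →
    D.comul (c * d) = ∑ i, ∑ j, D.tmul (a i * a' j) (b i * b' j)
  counit_mul_source : ∀ c d : C, D.counit (c * d) = D.counit (c * D.source (D.counit d))
  counit_mul_target : ∀ c d : C, D.counit (c * d) = D.counit (c * D.target (op (D.counit d)))

/-- `τ` is an antipode of the left bialgebroid (which then is a Hopf algebroid): an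
anti-automorphism of the ring `C` with
`τ ∘ target = source`, `τ⁻¹(c₂)₁ ⊗ τ⁻¹(c₂)₂ c₁ = τ⁻¹(c) ⊗ 1`, `τ(c₁)₁ c₂ ⊗ τ(c₁)₂ = 1 ⊗ τ(c)`. -/
structure IsAntipode (D : BialgebroidData R C) (τ : C ≃+ C) : Prop where
  map_mul : ∀ c d : C, τ (c * d) = τ d * τ c
  map_target : ∀ r : R, τ (D.target (op r)) = D.source r
  antipode_inv : ∀ (c : C) {n : ℕ} (a b : Fin n → C), D.Sweedler c a b →
    ∑ i, D.mulSnd (a i) (D.comul (τ.symm (b i))) = D.tmul (τ.symm c) 1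
  antipode : ∀ (c : C) {n : ℕ} (a b : Fin n → C), D.Sweedler c a b →
    ∑ i, D.mulFst (b i) (D.comul (τ (a i))) = D.tmul 1 (τ c)

/-- Homomorphisms of left `R`-bialgebroids. -/
structure IsBialgebroidHom (D : BialgebroidData R C) (D' : BialgebroidData R C') (f : C →+* C') :
    Prop where
  map_source : ∀ r, f (D.source r) = D'.source r
  map_target : ∀ r, f (D.target r) = D'.target r
  map_counit : ∀ c, D'.counit (f c) = D.counit c
  map_comul : ∀ (c : C) {n : ℕ} (a b : Fin n → C), D.Sweedler c a b →
    D'.comul (f c) = ∑ i, D'.tmul (f (a i)) (f (b i))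

end BialgebroidData

end Bialgebroids

/-! The enveloping algebra `R^e = R ⊗_k R^op` as a Hopf algebroid. -/

section Enveloping

variable (k R : Type*) [CommRing k] [Ring R] [Algebra k R]

/-- `source r = r ⊗ 1`, `target r = 1 ⊗ r̄`. -/
def envST : SourceTarget R (R ⊗[k] Rᵐᵒᵖ) where
  source := (Algebra.TensorProduct.includeLeft : R →ₐ[k] R ⊗[k] Rᵐᵒᵖ).toRingHom
  target := (Algebra.TensorProduct.includeRight : Rᵐᵒᵖ →ₐ[k] R ⊗[k] Rᵐᵒᵖ).toRingHom
  commute r s := by simp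

theorem envST_source (r : R) : (envST k R).source r = r ⊗ₜ[k] (1 : Rᵐᵒᵖ) := rfl

theorem envST_target (r : Rᵐᵒᵖ) : (envST k R).target r = (1 : R) ⊗ₜ[k] r := rfl

/-- `Δ(r ⊗ s̄) = (r ⊗ 1) ⊗_R (1 ⊗ s̄)` and `ε(r ⊗ s̄) = r s`. -/
def envData : BialgebroidData R (R ⊗[k] Rᵐᵒᵖ) where
  toSourceTarget := envST k R
  comul := TensorProduct.liftAddHom
    (((BalTens.tmul _ _).comp (envST k R).source.toAddMonoidHom).compl₂
      (envST k R).target.toAddMonoidHom) <| by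
    intro z r s
    have h := BalTens.tmul_balanced (actR := fun (r : R) c => (envST k R).target (op r) * c)
      (actL := fun (r : R) c => (envST k R).source r * c) (algebraMap k R z)
      ((envST k R).source r) ((envST k R).target s)
    have h1 : (envST k R).target (op (algebraMap k R z)) * (envST k R).source r
        = (envST k R).source (z • r) := by
      rw [envST_source, envST_source, envST_target, Algebra.TensorProduct.tmul_mul_tmul,
        ← MulOpposite.algebraMap_apply, Algebra.algebraMap_eq_smul_one, one_mul, mul_one,
        TensorProduct.tmul_smul, TensorProduct.smul_tmul']
    have h2 : (envST k R).source (algebraMap k R z) * (envST k R).target s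
        = (envST k R).target (z • s) := by
      rw [envST_source, envST_target, envST_target, Algebra.TensorProduct.tmul_mul_tmul,
        Algebra.algebraMap_eq_smul_one, one_mul, mul_one, TensorProduct.smul_tmul]
    simp only [h1, h2] at h
    exact h
  counit := TensorProduct.liftAddHom
    (AddMonoidHom.mul.compl₂ (MulOpposite.opAddEquiv (α := R)).symm.toAddMonoidHom) <| by
    intro z r s
    simp

/-- The twist `r ⊗ s̄ ↦ s ⊗ r̄` of `R^e`. -/
def envTwist : (R ⊗[k] Rᵐᵒᵖ) ≃+ (R ⊗[k] Rᵐᵒᵖ) :=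
  ((TensorProduct.comm k R Rᵐᵒᵖ).trans
    (TensorProduct.congr (MulOpposite.opLinearEquiv k).symm
      (MulOpposite.opLinearEquiv k))).toAddEquiv

theorem envData_comul_tmul (r s : R) : (envData k R).comul (r ⊗ₜ[k] op s) =
    (envData k R).tmul (r ⊗ₜ[k] 1) (1 ⊗ₜ[k] op s) := rfl

theorem envData_counit_tmul (r s : R) : (envData k R).counit (r ⊗ₜ[k] op s) = r * s := rfl

theorem envTwist_tmul (r s : R) : envTwist k R (r ⊗ₜ[k] op s) = s ⊗ₜ[k] op r := rfl

end Enveloping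

/-! The left bialgebroid `R^e ⋈ G` for a group `G` acting on a `K`-algebra `R`. -/

section Bowtie

/-- `R^e ⋈ G`; as a module it is `R ⊗_K R^op ⊗_K K[G]`, written as the finitely supported functions
`G → R ⊗_K R^op`; the element `r ⊗ s̄ ⋈ σ` is `Bowtie.mk σ (r ⊗ s̄)`. -/
def Bowtie (K R G : Type*) [CommRing K] [Ring R] [Algebra K R] := G →₀ (R ⊗[K] Rᵐᵒᵖ)

namespace Bowtie

variable {K R G : Type*} [CommRing K] [Ring R] [Algebra K R]

instance : AddCommGroup (Bowtie K R G) := inferInstanceAs (AddCommGroup (G →₀ (R ⊗[K] Rᵐᵒᵖ)))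

/-- `p ⋈ σ`. -/
def mk (σ : G) : (R ⊗[K] Rᵐᵒᵖ) →+ Bowtie K R G := Finsupp.singleAddHom σ

/-- The additive map on `R^e ⋈ G` with given restrictions to the summands `R^e ⋈ σ`. -/
def lift {P : Type*} [AddCommGroup P] (f : G → (R ⊗[K] Rᵐᵒᵖ) →+ P) : Bowtie K R G →+ P :=
  Finsupp.liftAddHom f

@[simp] theorem lift_mk {P : Type*} [AddCommGroup P] (f : G → (R ⊗[K] Rᵐᵒᵖ) →+ P) (σ : G)
    (p : R ⊗[K] Rᵐᵒᵖ) : lift f (mk σ p) = f σ p :=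
  Finsupp.liftAddHom_apply_single f σ p

theorem hom_ext {P : Type*} [AddCommGroup P] {f g : Bowtie K R G →+ P}
    (h : ∀ σ p, f (mk σ p) = g (mk σ p)) : f = g :=
  Finsupp.addHom_ext h

instance [One G] : One (Bowtie K R G) := ⟨mk 1 1⟩

theorem one_def [One G] : (1 : Bowtie K R G) = mk 1 1 := rfl

variable [Group G] [MulSemiringAction G R] [SMulCommClass G K R]

/-- `r ⊗ s̄ ↦ σ(r) ⊗ s̄`. -/
def actL (σ : G) : R ⊗[K] Rᵐᵒᵖ →ₐ[K] R ⊗[K] Rᵐᵒᵖ :=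
  Algebra.TensorProduct.map (MulSemiringAction.toAlgHom K R σ) (AlgHom.id K Rᵐᵒᵖ)

/-- `r ⊗ s̄ ↦ r ⊗ \overline{σ⁻¹(s)}`. -/
def actR (σ : G) : R ⊗[K] Rᵐᵒᵖ →ₐ[K] R ⊗[K] Rᵐᵒᵖ :=
  Algebra.TensorProduct.map (AlgHom.id K R) (AlgHom.op (MulSemiringAction.toAlgHom K R σ⁻¹))

@[simp] theorem actL_tmul (σ : G) (r : R) (s : Rᵐᵒᵖ) :
    actL σ (r ⊗ₜ[K] s) = (σ • r) ⊗ₜ[K] s := rfl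

@[simp] theorem actR_tmul (σ : G) (r : R) (s : Rᵐᵒᵖ) :
    actR σ (r ⊗ₜ[K] s) = r ⊗ₜ[K] op (σ⁻¹ • unop s) := rfl

theorem actL_one (p : R ⊗[K] Rᵐᵒᵖ) : actL (1 : G) p = p := by
  induction p with
  | zero => simp
  | tmul r s => simp
  | add p q hp hq => rw [map_add, hp, hq]

theorem actR_one (p : R ⊗[K] Rᵐᵒᵖ) : actR (1 : G) p = p := by
  induction p with
  | zero => simp
  | tmul r s => simp
  | add p q hp hq => rw [map_add, hp, hq]

theorem actL_mul (σ τ : G) (p : R ⊗[K] Rᵐᵒᵖ) : actL (σ * τ) p = actL σ (actL τ p) := by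
  induction p with
  | zero => simp
  | tmul r s => simp [mul_smul]
  | add p q hp hq => simp only [map_add, hp, hq]

theorem actR_mul (σ τ : G) (p : R ⊗[K] Rᵐᵒᵖ) : actR (σ * τ) p = actR τ (actR σ p) := by
  induction p with
  | zero => simp
  | tmul r s => simp [mul_smul]
  | add p q hp hq => simp only [map_add, hp, hq]

theorem actR_actL (σ τ : G) (p : R ⊗[K] Rᵐᵒᵖ) : actR τ (actL σ p) = actL σ (actR τ p) := by
  induction p with
  | zero => simp
  | tmul r s => simp
  | add p q hp hq => simp only [map_add, hp, hq]

/-- The multiplication, `(p ⋈ σ)(q ⋈ τ) = actR τ p * actL σ q ⋈ στ`; on pure tensors,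
`(r ⊗ s̄ ⋈ σ)(u ⊗ v̄ ⋈ τ) = rσ(u) ⊗ \overline{vτ⁻¹(s)} ⋈ στ`. -/
def mulHom : Bowtie K R G →+ Bowtie K R G →+ Bowtie K R G :=
  lift fun σ => AddMonoidHom.flip <| lift fun τ =>
    (((AddMonoidHom.mul.compr₂ (mk (σ * τ))).comp
      (actR τ).toRingHom.toAddMonoidHom).compl₂ (actL σ).toRingHom.toAddMonoidHom).flip

instance : Mul (Bowtie K R G) := ⟨fun x y => mulHom x y⟩

theorem mk_mul_mk (σ τ : G) (p q : R ⊗[K] Rᵐᵒᵖ) :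
    (mk σ p * mk τ q : Bowtie K R G) = mk (σ * τ) (actR τ p * actL σ q) := by
  change mulHom (mk σ p) (mk τ q) = _
  rw [mulHom, lift_mk, AddMonoidHom.flip_apply, lift_mk]
  rfl

instance : Ring (Bowtie K R G) where
  __ := (inferInstance : AddCommGroup (Bowtie K R G))
  left_distrib x y z := map_add (mulHom x) y z
  right_distrib x y z := by
    change mulHom (x + y) z = mulHom x z + mulHom y z
    rw [map_add, AddMonoidHom.add_apply]
  zero_mul x := by
    change mulHom 0 x = 0
    rw [map_zero, AddMonoidHom.zero_apply]
  mul_zero x := map_zero (mulHom x)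
  mul_assoc x y z := by
    have h : (mulHom.compr₂ mulHom : Bowtie K R G →+ _ →+ _ →+ _) =
        AddMonoidHom.compl₂ (AddMonoidHom.compHom.comp mulHom) mulHom := by
      refine hom_ext fun σ p => hom_ext fun τ q => hom_ext fun ρ r => ?_
      change (mk σ p * mk τ q) * mk ρ r = mk σ p * (mk τ q * mk ρ r)
      rw [mk_mul_mk, mk_mul_mk, mk_mul_mk, mk_mul_mk, map_mul (actR ρ), map_mul (actL σ), actR_mul,
        actL_mul, actR_actL, mul_assoc σ, mul_assoc (actR ρ (actR τ p))]
    exact DFunLike.congr_fun (DFunLike.congr_fun (DFunLike.congr_fun h x) y) z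
  one_mul x := by
    have h : mulHom (1 : Bowtie K R G) = AddMonoidHom.id _ := by
      refine hom_ext fun σ p => ?_
      change 1 * mk σ p = mk σ p
      rw [one_def, mk_mul_mk, map_one, one_mul, one_mul, actL_one]
    exact DFunLike.congr_fun h x
  mul_one x := by
    have h : mulHom.flip (1 : Bowtie K R G) = AddMonoidHom.id _ := by
      refine hom_ext fun σ p => ?_
      change mk σ p * 1 = mk σ p
      rw [one_def, mk_mul_mk, map_one, mul_one, mul_one, actR_one]
    exact DFunLike.congr_fun h x

/-- `source r = r ⊗ 1 ⋈ e`, `target r = 1 ⊗ r̄ ⋈ e`. -/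
def sourceTarget (K R G : Type*) [CommRing K] [Ring R] [Algebra K R] [Group G]
    [MulSemiringAction G R] [SMulCommClass G K R] : SourceTarget R (Bowtie K R G) where
  source :=
    { toFun := fun r => mk 1 (r ⊗ₜ[K] 1)
      map_one' := rfl
      map_mul' := fun r s => by rw [mk_mul_mk, actL_one, actR_one]; simp
      map_zero' := by simp
      map_add' := fun r s => by rw [TensorProduct.add_tmul, map_add] }
  target :=
    { toFun := fun s => mk 1 (1 ⊗ₜ[K] s)
      map_one' := rfl
      map_mul' := fun r s => by rw [mk_mul_mk, actL_one, actR_one]; simp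
      map_zero' := by simp
      map_add' := fun r s => by rw [TensorProduct.tmul_add, map_add] }
  commute r s := by
    simp only [RingHom.coe_mk, MonoidHom.coe_mk, OneHom.coe_mk]
    rw [mk_mul_mk, mk_mul_mk, actL_one, actL_one, actR_one, actR_one]; simp

theorem source_apply (r : R) :
    (sourceTarget K R G).source r = mk 1 (r ⊗ₜ[K] (1 : Rᵐᵒᵖ)) := rfl

theorem target_apply (s : Rᵐᵒᵖ) :
    (sourceTarget K R G).target s = mk 1 ((1 : R) ⊗ₜ[K] s) := rfl

/-- `Δ(r ⊗ s̄ ⋈ σ) = (r ⊗ 1 ⋈ σ) ⊗_R (1 ⊗ s̄ ⋈ σ)`. -/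
def comulHom (K R G : Type*) [CommRing K] [Ring R] [Algebra K R] [Group G]
    [MulSemiringAction G R] [SMulCommClass G K R] :
    Bowtie K R G →+ (sourceTarget K R G).Tens :=
  lift fun σ => TensorProduct.liftAddHom
    (((BalTens.tmul (fun (r : R) c => (sourceTarget K R G).target (op r) * c)
      (fun (r : R) c => (sourceTarget K R G).source r * c)).comp ((mk σ).comp
        (Algebra.TensorProduct.includeLeft : R →ₐ[K] R ⊗[K] Rᵐᵒᵖ).toRingHom.toAddMonoidHom)).compl₂
      ((mk σ).comp
        (Algebra.TensorProduct.includeRight :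
          Rᵐᵒᵖ →ₐ[K] R ⊗[K] Rᵐᵒᵖ).toRingHom.toAddMonoidHom)) <| by
    intro z r s
    have h := BalTens.tmul_balanced
      (actR := fun (r : R) c => (sourceTarget K R G).target (op r) * c)
      (actL := fun (r : R) c => (sourceTarget K R G).source r * c) (algebraMap K R z)
      (mk σ (r ⊗ₜ[K] 1)) (mk σ (1 ⊗ₜ[K] s))
    have h1 : (sourceTarget K R G).target (op (algebraMap K R z)) * mk σ (r ⊗ₜ[K] 1)
        = mk σ ((z • r) ⊗ₜ[K] 1) := by
      rw [target_apply, mk_mul_mk, one_mul, actL_one, actR_tmul, MulOpposite.unop_op,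
        smul_algebraMap, Algebra.TensorProduct.tmul_mul_tmul,
        ← MulOpposite.algebraMap_apply, Algebra.algebraMap_eq_smul_one, one_mul, mul_one,
        TensorProduct.tmul_smul, TensorProduct.smul_tmul']
    have h2 : (sourceTarget K R G).source (algebraMap K R z) * mk σ (1 ⊗ₜ[K] s)
        = mk σ (1 ⊗ₜ[K] (z • s)) := by
      rw [source_apply, mk_mul_mk, one_mul, actL_one, actR_tmul, MulOpposite.unop_one, smul_one,
        MulOpposite.op_one, Algebra.TensorProduct.tmul_mul_tmul,
        Algebra.algebraMap_eq_smul_one, one_mul, mul_one, TensorProduct.smul_tmul]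
    simp only [h1, h2] at h
    exact h

/-- `Δ(r ⊗ s̄ ⋈ σ) = (r ⊗ 1 ⋈ σ) ⊗_R (1 ⊗ s̄ ⋈ σ)` and `ε(r ⊗ s̄ ⋈ σ) = r σ(s)`. -/
def data (K R G : Type*) [CommRing K] [Ring R] [Algebra K R] [Group G]
    [MulSemiringAction G R] [SMulCommClass G K R] : BialgebroidData R (Bowtie K R G) where
  toSourceTarget := sourceTarget K R G
  comul := comulHom K R G
  counit := lift fun σ => TensorProduct.liftAddHom
    (AddMonoidHom.mul.compl₂ ((DistribSMul.toAddMonoidHom R σ).comp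
      (MulOpposite.opAddEquiv (α := R)).symm.toAddMonoidHom)) <| by
    intro z r s
    simp [smul_comm σ z]

theorem data_comul (σ : G) (r s : R) : (data K R G).comul (mk σ (r ⊗ₜ[K] op s)) =
    (data K R G).tmul (mk σ (r ⊗ₜ[K] 1)) (mk σ (1 ⊗ₜ[K] op s)) := by
  change comulHom K R G (mk σ _) = _
  rw [comulHom, lift_mk]; rfl

theorem data_counit (σ : G) (r s : R) :
    (data K R G).counit (mk σ (r ⊗ₜ[K] op s)) = r * σ • s := by
  rw [data, lift_mk]; rfl

theorem mk_tmul_mul_mk_tmul (σ τ : G) (r s u v : R) :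
    (mk σ (r ⊗ₜ[K] op s) * mk τ (u ⊗ₜ[K] op v) : Bowtie K R G) =
      mk (σ * τ) ((r * σ • u) ⊗ₜ[K] op (v * τ⁻¹ • s)) := by
  rw [mk_mul_mk, actR_tmul, actL_tmul, Algebra.TensorProduct.tmul_mul_tmul]; rfl

end Bowtie

end Bowtie

/-! Algebra extensions `ι : B → A` over the ground ring `K`. -/

section Extensions

variable {K A B : Type*} [CommRing K] [Ring A] [Algebra K A] [Ring B] [Algebra K B]
  (ι : B →ₐ[K] A)

/-- The tensor-square `A ⊗_B A`. -/
abbrev TensSq := BalTens (fun (b : B) (x : A) => x * ι b) (fun (b : B) (y : A) => ι b * y)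

namespace TensSq

/-- The element `x ⊗ y` of `A ⊗_B A`. -/
abbrev tmul (x y : A) : TensSq ι := BalTens.tmul _ _ x y

/-- The left `A`-action `a (x ⊗ y) = a x ⊗ y`. -/
def lmul (a : A) : TensSq ι →+ TensSq ι :=
  BalTens.lift ((BalTens.tmul _ _).comp (AddMonoidHom.mulLeft a)) <| by
    intro b x y
    simp only [AddMonoidHom.comp_apply, AddMonoidHom.coe_mulLeft, ← mul_assoc]
    exact BalTens.tmul_balanced (actR := fun (b : B) (x : A) => x * ι b)
      (actL := fun (b : B) (y : A) => ι b * y) _ _ _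

/-- The right `A`-action `(x ⊗ y) a = x ⊗ y a`. -/
def rmul (a : A) : TensSq ι →+ TensSq ι :=
  BalTens.lift ((BalTens.tmul _ _).compl₂ (AddMonoidHom.mulRight a)) <| by
    intro b x y
    simp only [AddMonoidHom.compl₂_apply, AddMonoidHom.mulRight_apply, mul_assoc]
    exact BalTens.tmul_balanced (actR := fun (b : B) (x : A) => x * ι b)
      (actL := fun (b : B) (y : A) => ι b * y) _ _ _

end TensSq

/-- The group `Aut_B(A)` of automorphisms of `A` that fix the elements of `B`. -/
def AutB : Subgroup (A ≃ₐ[K] A) where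
  carrier := {σ | ∀ b, σ (ι b) = ι b}
  one_mem' _ := rfl
  mul_mem' {σ τ} hσ hτ b := by rw [AlgEquiv.mul_apply, hτ b, hσ b]
  inv_mem' {σ} hσ b := by
    rw [← hσ b]
    exact (σ.symm_apply_apply (ι b)).trans (hσ b).symm

/-- The centralizer `R = C_A(B)`. -/
abbrev Cent : Subalgebra K A := Subalgebra.centralizer K (Set.range ι)

theorem mem_cent {a : A} : a ∈ Cent ι ↔ ∀ b, ι b * a = a * ι b := by
  simp [Subalgebra.mem_centralizer_iff]

/-- `Aut_B(A)` acts on `R` by restriction. -/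
instance : MulSemiringAction (AutB ι) (Cent ι) where
  smul σ r := ⟨σ.1 r.1, (mem_cent ι).2 fun b => by
    rw [← σ.2 b, ← map_mul, ← map_mul, (mem_cent ι).1 r.2 b]⟩
  one_smul _ := rfl
  mul_smul _ _ _ := rfl
  smul_zero σ := Subtype.ext (map_zero σ.1)
  smul_add σ r s := Subtype.ext (map_add σ.1 r.1 s.1)
  smul_one σ := Subtype.ext (map_one σ.1)
  smul_mul σ r s := Subtype.ext (map_mul σ.1 r.1 s.1)

theorem coe_autB_smul (σ : AutB ι) (r : Cent ι) : ((σ • r : Cent ι) : A) = σ.1 r.1 := rfl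

instance : SMulCommClass (AutB ι) K (Cent ι) where
  smul_comm σ k r := Subtype.ext (map_smul σ.1 k r.1)

/-- `R` is an algebra over the centre of `A`. -/
instance : Algebra (Subalgebra.center K A) (Cent ι) :=
  RingHom.toAlgebra' (Subalgebra.inclusion (Subalgebra.center_le_centralizer K _)).toRingHom
    fun z r => Subtype.ext ((Subalgebra.mem_center_iff.1 z.2 r.1).symm)

/-- `𝒮 = End _BA_B`, the algebra of `B`-bimodule endomorphisms of `A` under composition. -/
def BimodEnd : Subalgebra K (Module.End K A) where
  carrier := {f | (∀ b a, f (ι b * a) = ι b * f a) ∧ ∀ b a, f (a * ι b) = f a * ι b}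
  mul_mem' {f g} hf hg := by
    refine ⟨fun b a => ?_, fun b a => ?_⟩
    · rw [Module.End.mul_apply, hg.1, hf.1]; rfl
    · rw [Module.End.mul_apply, hg.2, hf.2]; rfl
  add_mem' {f g} hf hg := by
    refine ⟨fun b a => ?_, fun b a => ?_⟩
    · rw [LinearMap.add_apply, hg.1, hf.1, ← mul_add]; rfl
    · rw [LinearMap.add_apply, hg.2, hf.2, ← add_mul]; rfl
  algebraMap_mem' k := by
    refine ⟨fun b a => ?_, fun b a => ?_⟩
    · rw [Module.algebraMap_end_apply, Module.algebraMap_end_apply, mul_smul_comm]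
    · rw [Module.algebraMap_end_apply, Module.algebraMap_end_apply, smul_mul_assoc]

namespace BimodEnd

/-- Left multiplication `λ_r`. -/
def lam (r : Cent ι) : BimodEnd ι :=
  ⟨LinearMap.mulLeft K r.1, fun b a => by
    simp only [LinearMap.mulLeft_apply]
    rw [← mul_assoc, ← (mem_cent ι).1 r.2 b, mul_assoc], fun b a => by
    simp only [LinearMap.mulLeft_apply, mul_assoc]⟩

/-- Right multiplication `ρ_r`. -/
def rho (r : Cent ι) : BimodEnd ι :=
  ⟨LinearMap.mulRight K r.1, fun b a => by
    simp only [LinearMap.mulRight_apply, mul_assoc], fun b a => by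
    simp only [LinearMap.mulRight_apply]
    rw [mul_assoc, (mem_cent ι).1 r.2 b, mul_assoc]⟩

/-- A `B`-automorphism of `A` as an element of `𝒮`. -/
def aut (σ : AutB ι) : BimodEnd ι :=
  ⟨σ.1.toLinearMap, fun b a => by
    simp only [AlgEquiv.toLinearMap_apply]
    rw [map_mul, σ.2 b], fun b a => by
    simp only [AlgEquiv.toLinearMap_apply]
    rw [map_mul, σ.2 b]⟩

/-- Source `λ` and target `ρ`. -/
def sourceTarget : SourceTarget (Cent ι) (BimodEnd ι) where
  source :=
    { toFun := lam ι
      map_one' := by ext a; exact one_mul a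
      map_mul' := fun r s => by ext a; exact mul_assoc r.1 s.1 a
      map_zero' := by ext a; exact zero_mul a
      map_add' := fun r s => by ext a; exact add_mul r.1 s.1 a }
  target :=
    { toFun := fun r => rho ι (unop r)
      map_one' := by ext a; exact mul_one a
      map_mul' := fun r s => by ext a; exact (mul_assoc a (unop s).1 (unop r).1).symm
      map_zero' := by ext a; exact mul_zero a
      map_add' := fun r s => by ext a; exact mul_add a (unop r).1 (unop s).1 }
  commute r s := by ext a; exact (mul_assoc r.1 a (unop s).1).symm

/-- `t ↦ α(x t¹) t²`, where `t = t¹ ⊗ t² ∈ A ⊗_B A`. -/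
def evalAt (α : BimodEnd ι) (x : A) : TensSq ι →+ A :=
  BalTens.lift (AddMonoidHom.mul.comp
    (α.1.toAddMonoidHom.comp (AddMonoidHom.mulLeft x))) <| by
    intro b y z
    simp only [AddMonoidHom.comp_apply, AddMonoidHom.coe_mulLeft, AddMonoidHom.mul_apply,
      LinearMap.toAddMonoidHom_coe]
    rw [← mul_assoc, α.2.2, mul_assoc]

theorem evalAt_tmul (α : BimodEnd ι) (x y z : A) :
    evalAt ι α x (TensSq.tmul ι y z) = α.1 (x * y) * z := rfl

end BimodEnd

/-- Left depth two quasibases: `β i ∈ 𝒮` and `t i ∈ (A ⊗_B A)^B` with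
`∑ i, t i β_i(x) y = x ⊗ y` for all `x, y ∈ A`. -/
structure LeftD2QuasiBasis where
  n : ℕ
  β : Fin n → BimodEnd ι
  t : Fin n → TensSq ι
  central : ∀ i b, TensSq.lmul ι (ι b) (t i) = TensSq.rmul ι (ι b) (t i)
  sum_eq : ∀ x y : A, ∑ i, TensSq.rmul ι ((β i).1 x * y) (t i) = TensSq.tmul ι x y

namespace BimodEnd

theorem evalAt_add (α : BimodEnd ι) (x x' : A) (t : TensSq ι) :
    evalAt ι α (x + x') t = evalAt ι α x t + evalAt ι α x' t := by
  induction t using BalTens.induction_on with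
  | zero => simp only [map_zero, add_zero]
  | tmul y z =>
    rw [evalAt_tmul, evalAt_tmul, evalAt_tmul, add_mul, map_add, add_mul]
  | add v w hv hw => rw [map_add, map_add, map_add, hv, hw]; abel

theorem evalAt_smul (α : BimodEnd ι) (k : K) (x : A) (t : TensSq ι) :
    evalAt ι α (k • x) t = k • evalAt ι α x t := by
  induction t using BalTens.induction_on with
  | zero => simp only [map_zero, smul_zero]
  | tmul y z => rw [evalAt_tmul, evalAt_tmul, smul_mul_assoc, map_smul, smul_mul_assoc]
  | add v w hv hw => rw [map_add, map_add, hv, hw, smul_add]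

theorem add_evalAt (α β : BimodEnd ι) (x : A) (t : TensSq ι) :
    evalAt ι (α + β) x t = evalAt ι α x t + evalAt ι β x t := by
  induction t using BalTens.induction_on with
  | zero => simp only [map_zero, add_zero]
  | tmul y z => rw [evalAt_tmul, evalAt_tmul, evalAt_tmul, ← add_mul]; rfl
  | add v w hv hw => rw [map_add, map_add, map_add, hv, hw]; abel

theorem evalAt_mul_left (α : BimodEnd ι) (b : B) (x : A) (t : TensSq ι) :
    evalAt ι α (ι b * x) t = ι b * evalAt ι α x t := by
  induction t using BalTens.induction_on with
  | zero => simp only [map_zero, mul_zero]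
  | tmul y z => rw [evalAt_tmul, evalAt_tmul, mul_assoc, α.2.1, mul_assoc]
  | add v w hv hw => rw [map_add, map_add, hv, hw, mul_add]

theorem evalAt_mul_right (α : BimodEnd ι) (x a : A) (t : TensSq ι) :
    evalAt ι α (x * a) t = evalAt ι α x (TensSq.lmul ι a t) := by
  induction t using BalTens.induction_on with
  | zero => simp only [map_zero]
  | tmul y z =>
    change α.1 (x * a * y) * z = α.1 (x * (a * y)) * z
    rw [mul_assoc]
  | add v w hv hw => rw [map_add, map_add, map_add, hv, hw]

theorem evalAt_rmul (α : BimodEnd ι) (x a : A) (t : TensSq ι) :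
    evalAt ι α x (TensSq.rmul ι a t) = evalAt ι α x t * a := by
  induction t using BalTens.induction_on with
  | zero => simp only [map_zero, zero_mul]
  | tmul y z => exact (mul_assoc (α.1 (x * y)) z a).symm
  | add v w hv hw => rw [map_add, map_add, map_add, hv, hw, add_mul]

/-- The bimodule endomorphism `α(? t¹) t² : x ↦ α(x t¹) t²` for `t ∈ (A ⊗_B A)^B`. -/
def contract (t : TensSq ι) (ht : ∀ b, TensSq.lmul ι (ι b) t = TensSq.rmul ι (ι b) t)
    (α : BimodEnd ι) : BimodEnd ι :=
  ⟨{ toFun := fun x => evalAt ι α x t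
     map_add' := fun x x' => evalAt_add ι α x x' t
     map_smul' := fun k x => evalAt_smul ι α k x t },
    fun b x => evalAt_mul_left ι α b x t,
    fun b x => by
      change evalAt ι α (x * ι b) t = evalAt ι α x t * ι b
      rw [evalAt_mul_right, ht, evalAt_rmul]⟩

/-- The left bialgebroid data of `𝒮` over `R`: source `λ`, target `ρ`,
`Δ(α) = ∑ i, α(? t_i¹) t_i² ⊗ β_i` and `ε(α) = α(1)`. -/
def data (q : LeftD2QuasiBasis ι) : BialgebroidData (Cent ι) (BimodEnd ι) where
  toSourceTarget := sourceTarget ι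
  comul := AddMonoidHom.mk'
    (fun α => ∑ i, (sourceTarget ι).tmul (contract ι (q.t i) (q.central i) α) (q.β i)) <| by
    intro α β
    rw [← Finset.sum_add_distrib]
    refine Finset.sum_congr rfl fun i _ => ?_
    have h : contract ι (q.t i) (q.central i) (α + β) =
        contract ι (q.t i) (q.central i) α + contract ι (q.t i) (q.central i) β := by
      ext x
      exact add_evalAt ι α β x (q.t i)
    rw [h, SourceTarget.tmul, map_add]; rfl
  counit := AddMonoidHom.mk' (fun α => ⟨α.1 1, (mem_cent ι).2 fun b => by
    rw [← α.2.1, ← α.2.2, mul_one, one_mul]⟩) fun α β => rfl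

end BimodEnd

/-- `A ‖ B` is H-separable: `A ⊗_B A` is isomorphic to a direct summand of `A ^ N`, as
`A`-`A`-bimodules, for some positive integer `N`. -/
def IsHSeparable : Prop :=
  ∃ (N : ℕ) (_ : 0 < N) (f : TensSq ι →+ (Fin N → A)) (g : (Fin N → A) →+ TensSq ι),
    (∀ a t i, f (TensSq.lmul ι a t) i = a * f t i) ∧
    (∀ a t i, f (TensSq.rmul ι a t) i = f t i * a) ∧
    (∀ a v, g (fun i => a * v i) = TensSq.lmul ι a (g v)) ∧
    (∀ a v, g (fun i => v i * a) = TensSq.rmul ι a (g v)) ∧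
    ∀ t, g (f t) = t

/-- `A ⊗_B A` is isomorphic to a direct summand of `⨁_{σ ∈ 𝒢} A_σ ^ N`, as `A`-`A`-bimodules, for
some positive integer `N`, where `x · a · y = x a σ(y)` in `A_σ`. -/
def IsPseudoGaloisSet (𝒢 : Finset (AutB ι)) : Prop :=
  ∃ (N : ℕ) (_ : 0 < N) (f : TensSq ι →+ (𝒢 → Fin N → A)) (g : (𝒢 → Fin N → A) →+ TensSq ι),
    (∀ a t σ i, f (TensSq.lmul ι a t) σ i = a * f t σ i) ∧
    (∀ a t σ i, f (TensSq.rmul ι a t) σ i = f t σ i * σ.1.1 a) ∧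
    (∀ a v, g (fun σ i => a * v σ i) = TensSq.lmul ι a (g v)) ∧
    (∀ a v, g (fun σ i => v σ i * σ.1.1 a) = TensSq.rmul ι a (g v)) ∧
    ∀ t, g (f t) = t

/-- `A_σ` and `A_τ` are isomorphic as `A`-`A`-bimodules. -/
def TwistIso (σ τ : AutB ι) : Prop :=
  ∃ f : A ≃+ A, ∀ x a y, f (x * a * σ.1 y) = x * f a * τ.1 y

/-- The normalised data of a pseudo-Galois extension: `𝒢` satisfies the pseudo-Galois condition,
is minimal with this property, and `A_σ ≇ A_τ` for distinct `σ, τ ∈ 𝒢`. -/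
def IsMinimalPseudoGaloisSet (𝒢 : Finset (AutB ι)) : Prop :=
  IsPseudoGaloisSet ι 𝒢 ∧ (∀ 𝒢' ⊂ 𝒢, ¬ IsPseudoGaloisSet ι 𝒢') ∧
    ∀ σ ∈ 𝒢, ∀ τ ∈ 𝒢, σ ≠ τ → ¬ TwistIso ι σ τ

/-- Galois coordinates for `G`: `∑ a_i b_i = 1` and `∑ a_i σ(b_i) = 0` for `id ≠ σ ∈ G`. -/
def IsGaloisCoordinates (G : Subgroup (AutB ι)) {n : ℕ} (a b : Fin n → A) : Prop :=
  ∑ i, a i * b i = 1 ∧ ∀ σ ∈ G, σ ≠ 1 → ∑ i, a i * σ.1 (b i) = 0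

/-- `A ‖ B` is `G`-Galois: `G` is finite, `B` is the fixed subalgebra `A^G` (via the injection `ι`),
and Galois coordinates exist. -/
def IsGaloisExt (G : Subgroup (AutB ι)) : Prop :=
  Finite G ∧ Function.Injective ι ∧
    (∀ a : A, (∀ σ ∈ G, σ.1 a = a) → a ∈ ι.range) ∧
    ∃ (n : ℕ) (a b : Fin n → A), IsGaloisCoordinates ι G a b

/-- `R^e = R ⊗_k R^op` and `𝒮` are left bialgebroids over `R`, the twist is an antipode of `R^e`,
and `r ⊗ s̄ ↦ λ_r ∘ ρ_s` defines an isomorphism of bialgebroids `Ψ : R^e → 𝒮`; and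
`Ψ ∘ twist ∘ Ψ⁻¹` is an antipode of `𝒮`. -/
def EnvelopingIso (k : Type*) [CommRing k] [Algebra k (Cent ι)] (q : LeftD2QuasiBasis ι) : Prop :=
  (envData k (Cent ι)).IsLeftBialgebroid ∧
  (envData k (Cent ι)).IsAntipode (envTwist k (Cent ι)) ∧
  (BimodEnd.data ι q).IsLeftBialgebroid ∧
  ∃ Ψ : (Cent ι ⊗[k] (Cent ι)ᵐᵒᵖ) ≃+* BimodEnd ι,
    (∀ r s : Cent ι, Ψ (r ⊗ₜ[k] op s) = BimodEnd.lam ι r * BimodEnd.rho ι s) ∧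
    (envData k (Cent ι)).IsBialgebroidHom (BimodEnd.data ι q) Ψ ∧
    (BimodEnd.data ι q).IsAntipode
      ((Ψ.symm.toAddEquiv.trans (envTwist k (Cent ι))).trans Ψ.toAddEquiv)

end Extensions

end

/-!
Both parts rest on one description of the bialgebroid `𝒮 = End _BA_B`. A left depth two quasibasis
makes `𝒮` a finitely generated projective left `R`-module, with dual basis `β_i` and
`α ↦ α(t_i¹) t_i²` (`LeftD2QuasiBasis.sum_coeff_mul`). Hence the elements of `𝒮 ⊗_R 𝒮` and
`𝒮 ⊗_R 𝒮 ⊗_R 𝒮` are determined by the values `α(x) β(y)` and `α(x) β(y) γ(z)`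
(`BimodEnd.pair_separates`, `BimodEnd.pair₃_separates`). In these terms the coproduct is the dual of
the multiplication of `A`: `α₁(x) α₂(y) = α(x y)` (`BimodEnd.pair_comul`). In particular it does not
depend on the quasibasis, and each bialgebroid axiom for `𝒮` becomes an identity between values of
endomorphisms (`BimodEnd.data_isLeftBialgebroid`).

The bialgebroids `R^e` and `R^e ⋈ G` are both additively spanned by elements
`source r * target s * g σ`, where the `g σ` are grouplike and normalize the images of `R`. This
alone implies the axioms (`BialgebroidData.IsSpannedByGrouplikes.isLeftBialgebroid`), reduces the
antipode identities to these elements (`BialgebroidData.IsSpannedByGrouplikes.isAntipode`), and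
shows that a ring homomorphism to `𝒮` which respects source and target is one of bialgebroids as
soon as the `g σ` act on `A` by unital multiplicative maps
(`BimodEnd.isBialgebroidHom_of_grouplikes`).

If `A ‖ B` is H-separable, then `1 ⊗ 1 = ∑ r_i e_i` with `r_i ∈ R` and `e_i ∈ (A ⊗_B A)^A`, and so
`x ⊗ y = ∑ e_i x r_i y`: the `ρ_{r_i}` and `e_i` form a quasibasis, and
`α ↦ ∑ α(e_i¹) e_i² ⊗ r_i` is inverse to `r ⊗ s̄ ↦ λ_r ∘ ρ_s`, because the elements `e_i¹ v e_i²`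
are central in `A` for `v ∈ R` (`HSeparabilitySystem.invHom_envHom`). The antipode is transported
along this isomorphism.

If `A ‖ B` is `G`-Galois with coordinates `a_i`, `b_i`, then the `σ ∈ G` and
`t_σ = ∑ a_i ⊗ σ(b_i)` form a quasibasis (`IsGaloisCoordinates.sum_rmul_tensor`); the dual basis
expansion `α = ∑ α(t_σ¹) t_σ² σ` in `𝒮` is the isomorphism with `R ⋊ G`.
-/

noncomputable section

/-! ### Balanced tensor products and presentations -/

namespace BalTens

variable {R M N P : Type*} [AddCommGroup M] [AddCommGroup N] [AddCommGroup P]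
  {actR : R → M → M} {actL : R → N → N}

theorem addHom_ext {f g : BalTens actR actL →+ P}
    (h : ∀ m n, f (tmul actR actL m n) = g (tmul actR actL m n)) : f = g := by
  ext w
  induction w using BalTens.induction_on with
  | zero => simp only [map_zero]
  | tmul m n => exact h m n
  | add v w hv hw => rw [map_add, map_add, hv, hw]

theorem exists_eq_sum_tmul (w : BalTens actR actL) :
    ∃ (n : ℕ) (a : Fin n → M) (b : Fin n → N), w = ∑ i, tmul actR actL (a i) (b i) := by
  induction w using BalTens.induction_on with
  | zero => exact ⟨0, Fin.elim0, Fin.elim0, by simp⟩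
  | tmul m n => exact ⟨1, fun _ => m, fun _ => n, by simp⟩
  | add v w hv hw =>
    obtain ⟨n, a, b, rfl⟩ := hv
    obtain ⟨m, a', b', rfl⟩ := hw
    exact ⟨n + m, Fin.append a a', Fin.append b b', by simp [Fin.sum_univ_add]⟩

end BalTens

namespace SourceTarget

variable {R C C' : Type*} [Ring R] [Ring C] [Ring C'] (S : SourceTarget R C)

theorem tmul_balanced (r : R) (a b : C) :
    S.tmul (S.target (op r) * a) b = S.tmul a (S.source r * b) :=
  BalTens.tmul_balanced (actR := fun (r : R) (c : C) => S.target (op r) * c)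
    (actL := fun (r : R) (c : C) => S.source r * c) r a b

theorem glueRight_balanced (r : R) (w : S.Tens) (c : C) :
    S.glueRight (S.tensActR r w) c = S.glueRight w (S.source r * c) :=
  BalTens.tmul_balanced (actR := fun (r : R) (w : S.Tens) => S.tensActR r w)
    (actL := fun (r : R) (c : C) => S.source r * c) r w c

theorem mulFst_tmul (a b c : C) : S.mulFst c (S.tmul a b) = S.tmul (a * c) b := rfl

theorem mulSnd_tmul (a b c : C) : S.mulSnd c (S.tmul a b) = S.tmul a (b * c) := rfl

theorem tmul_add (a b b' : C) : S.tmul a (b + b') = S.tmul a b + S.tmul a b' := map_add _ _ _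

theorem add_tmul (a a' b : C) : S.tmul (a + a') b = S.tmul a b + S.tmul a' b := by
  simp only [SourceTarget.tmul, map_add, AddMonoidHom.add_apply]

theorem mulFst_add (c c' : C) : S.mulFst (c + c') = S.mulFst c + S.mulFst c' :=
  BalTens.addHom_ext fun a b => by
    change S.tmul (a * (c + c')) b = S.tmul (a * c) b + S.tmul (a * c') b
    rw [mul_add, add_tmul]

theorem mulSnd_add (c c' : C) : S.mulSnd (c + c') = S.mulSnd c + S.mulSnd c' :=
  BalTens.addHom_ext fun a b => by
    change S.tmul a (b * (c + c')) = S.tmul a (b * c) + S.tmul a (b * c')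
    rw [mul_add, tmul_add]

theorem mulFst_mul (c c' : C) (w : S.Tens) : S.mulFst (c * c') w = S.mulFst c' (S.mulFst c w) := by
  refine DFunLike.congr_fun (BalTens.addHom_ext (f := S.mulFst (c * c'))
    (g := (S.mulFst c').comp (S.mulFst c)) fun a b => ?_) w
  change S.tmul (a * (c * c')) b = S.tmul (a * c * c') b
  rw [mul_assoc]

theorem mulSnd_mul (c c' : C) (w : S.Tens) : S.mulSnd (c * c') w = S.mulSnd c' (S.mulSnd c w) := by
  refine DFunLike.congr_fun (BalTens.addHom_ext (f := S.mulSnd (c * c'))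
    (g := (S.mulSnd c').comp (S.mulSnd c)) fun a b => ?_) w
  change S.tmul a (b * (c * c')) = S.tmul a (b * c * c')
  rw [mul_assoc]

theorem glueLeft_add (c c' : C) : S.glueLeft (c + c') = S.glueLeft c + S.glueLeft c' :=
  BalTens.addHom_ext fun a b => by
    change S.glueRight (S.tmul (c + c') a) b =
      S.glueRight (S.tmul c a) b + S.glueRight (S.tmul c' a) b
    rw [add_tmul]
    simp only [SourceTarget.glueRight, map_add, AddMonoidHom.add_apply]

/-- The map `a ⊗ b ↦ f(a) ⊗ g(b)` between balanced tensor squares, where `f` intertwines left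
multiplication by the targets, and `g` by the sources, along a map `φ` of base rings. -/
def mapTens {R' : Type*} [Ring R'] (S' : SourceTarget R' C') (φ : R → R') (f g : C →+ C')
    (hf : ∀ r c, f (S.target (op r) * c) = S'.target (op (φ r)) * f c)
    (hg : ∀ r c, g (S.source r * c) = S'.source (φ r) * g c) : S.Tens →+ S'.Tens :=
  BalTens.lift (((BalTens.tmul _ _).comp f).compl₂ g) <| by
    intro r a b
    simp only [AddMonoidHom.compl₂_apply, AddMonoidHom.comp_apply]
    rw [hf, hg]
    exact S'.tmul_balanced _ _ _

/-- `a ⊗ b ↦ source r * a ⊗ b`, the left `R`-action on `C ⊗_R C`. -/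
def sourceMul (r : R) : S.Tens →+ S.Tens :=
  S.mapTens S id (AddMonoidHom.mulLeft (S.source r)) (AddMonoidHom.id C)
    (fun q c => by simp only [AddMonoidHom.coe_mulLeft, id, ← mul_assoc, S.commute])
    (fun q c => rfl)

theorem glueLeft_target_mul (r : R) (c : C) (w : S.Tens) :
    S.glueLeft (S.target (op r) * c) w = S.glueLeft c (S.sourceMul r w) := by
  induction w using BalTens.induction_on with
  | zero => simp only [map_zero]
  | tmul a b =>
    change S.glueRight (S.tmul (S.target (op r) * c) a) b =
      S.glueRight (S.tmul c (S.source r * a)) b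
    rw [tmul_balanced]
  | add v w hv hw => simp only [map_add, hv, hw]

end SourceTarget

namespace BialgebroidData

variable {R C C' : Type*} [Ring R] [Ring C] [Ring C'] {D : BialgebroidData R C}
  {D' : BialgebroidData R C'}

theorem exists_sweedler (D : BialgebroidData R C) (c : C) :
    ∃ (n : ℕ) (a b : Fin n → C), D.Sweedler c a b :=
  BalTens.exists_eq_sum_tmul (D.comul c)

namespace IsLeftBialgebroid

theorem comul_source_self (h : D.IsLeftBialgebroid) (r : R) :
    D.comul (D.source r) = D.tmul (D.source r) 1 := by
  have := h.comul_source r 1 (n := 1) (fun _ => 1) (fun _ => 1) (by simp [Sweedler, h.comul_one])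
  simpa using this

theorem comul_target_self (h : D.IsLeftBialgebroid) (r : R) :
    D.comul (D.target (op r)) = D.tmul 1 (D.target (op r)) := by
  have := h.comul_target r 1 (n := 1) (fun _ => 1) (fun _ => 1) (by simp [Sweedler, h.comul_one])
  simpa using this

theorem comul_mul_source (h : D.IsLeftBialgebroid) (c : C) (r : R) :
    D.comul (c * D.source r) = D.mulFst (D.source r) (D.comul c) := by
  obtain ⟨n, a, b, hab⟩ := D.exists_sweedler c
  have := h.comul_mul c (D.source r) (m := 1) a b (fun _ => D.source r) (fun _ => 1) hab
    (by simp [Sweedler, h.comul_source_self])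
  rw [this, hab, map_sum]
  refine Finset.sum_congr rfl fun i _ => ?_
  simp [SourceTarget.mulFst_tmul]

theorem comul_mul_target (h : D.IsLeftBialgebroid) (c : C) (r : R) :
    D.comul (c * D.target (op r)) = D.mulSnd (D.target (op r)) (D.comul c) := by
  obtain ⟨n, a, b, hab⟩ := D.exists_sweedler c
  have := h.comul_mul c (D.target (op r)) (m := 1) a b (fun _ => 1) (fun _ => D.target (op r)) hab
    (by simp [Sweedler, h.comul_target_self])
  rw [this, hab, map_sum]
  refine Finset.sum_congr rfl fun i _ => ?_
  simp [SourceTarget.mulSnd_tmul]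

end IsLeftBialgebroid

/-! ### Bialgebroids spanned by grouplike elements over the base -/

/-- The ring `C` is additively spanned by the elements `source r * target s * g σ`, where the `g σ`
are grouplike and normalize the source and target maps via endomorphisms `act σ` of `R`. -/
structure IsSpannedByGrouplikes {G : Type*} [Monoid G] (D : BialgebroidData R C)
    (act : G → R →+* R) (g : G → C) : Prop where
  span : AddSubgroup.closure {c | ∃ r s σ, c = D.source r * D.target (op s) * g σ} = ⊤
  comul_gen : ∀ r s σ, D.comul (D.source r * D.target (op s) * g σ) =
    D.tmul (D.source r * g σ) (D.target (op s) * g σ)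
  counit_gen : ∀ r s σ, D.counit (D.source r * D.target (op s) * g σ) = r * s
  grouplike_one : g 1 = 1
  grouplike_mul : ∀ σ τ, g (σ * τ) = g σ * g τ
  mul_source : ∀ σ r, g σ * D.source r = D.source (act σ r) * g σ
  mul_target : ∀ σ r, g σ * D.target (op r) = D.target (op (act σ r)) * g σ

namespace IsSpannedByGrouplikes

variable {G : Type*} [Monoid G] {act : G → R →+* R} {g : G → C}

theorem addHom_ext {P : Type*} [AddCommGroup P] (h : D.IsSpannedByGrouplikes act g)
    {f f' : C →+ P} (hf : ∀ r s σ, f (D.source r * D.target (op s) * g σ) =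
      f' (D.source r * D.target (op s) * g σ)) : f = f' :=
  AddMonoidHom.eq_of_eqOn_dense h.span (by rintro _ ⟨r, s, σ, rfl⟩; exact hf r s σ)

theorem comul_source_mul (h : D.IsSpannedByGrouplikes act g) (r : R) (c : C) :
    D.comul (D.source r * c) = D.sourceMul r (D.comul c) := by
  refine DFunLike.congr_fun (h.addHom_ext (f := D.comul.comp (AddMonoidHom.mulLeft (D.source r)))
    (f' := (D.sourceMul r).comp D.comul) fun r' s σ => ?_) c
  simp only [AddMonoidHom.comp_apply, AddMonoidHom.coe_mulLeft]
  rw [← mul_assoc, ← mul_assoc, ← map_mul, h.comul_gen, h.comul_gen, map_mul, mul_assoc]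
  rfl

theorem comul_target_mul (h : D.IsSpannedByGrouplikes act g) (r : R) (c : C) :
    D.comul (D.target (op r) * c) = D.tensActR r (D.comul c) := by
  refine DFunLike.congr_fun (h.addHom_ext (f := D.comul.comp
    (AddMonoidHom.mulLeft (D.target (op r))))
    (f' := (D.tensActR r).comp D.comul) fun r' s σ => ?_) c
  simp only [AddMonoidHom.comp_apply, AddMonoidHom.coe_mulLeft]
  rw [h.comul_gen, ← mul_assoc, ← mul_assoc, ← D.commute, mul_assoc (D.source r'), ← map_mul,
    ← MulOpposite.op_mul, h.comul_gen, MulOpposite.op_mul, map_mul, mul_assoc]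
  rfl

/-- `a ⊗ b ↦ g σ * a ⊗ g σ * b`. -/
def grouplikeMul (h : D.IsSpannedByGrouplikes act g) (σ : G) : D.Tens →+ D.Tens :=
  D.mapTens D.toSourceTarget (act σ) (AddMonoidHom.mulLeft (g σ)) (AddMonoidHom.mulLeft (g σ))
    (fun r c => by simp only [AddMonoidHom.coe_mulLeft, ← mul_assoc, h.mul_target])
    (fun r c => by simp only [AddMonoidHom.coe_mulLeft, ← mul_assoc, h.mul_source])

theorem comul_grouplike_mul (h : D.IsSpannedByGrouplikes act g) (σ : G) (c : C) :
    D.comul (g σ * c) = h.grouplikeMul σ (D.comul c) := by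
  refine DFunLike.congr_fun (h.addHom_ext (f := D.comul.comp (AddMonoidHom.mulLeft (g σ)))
    (f' := (h.grouplikeMul σ).comp D.comul) fun r s τ => ?_) c
  simp only [AddMonoidHom.comp_apply, AddMonoidHom.coe_mulLeft]
  have e : g σ * (D.source r * D.target (op s) * g τ) =
      D.source (act σ r) * D.target (op (act σ s)) * g (σ * τ) := by
    rw [← mul_assoc, ← mul_assoc, h.mul_source, mul_assoc (D.source _), h.mul_target,
      h.grouplike_mul]
    simp only [mul_assoc]
  rw [e, h.comul_gen, h.comul_gen, h.grouplike_mul, ← mul_assoc, ← mul_assoc, ← h.mul_source,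
    ← h.mul_target, mul_assoc, mul_assoc]
  rfl

theorem counit_source_mul (h : D.IsSpannedByGrouplikes act g) (r : R) (c : C) :
    D.counit (D.source r * c) = r * D.counit c := by
  refine DFunLike.congr_fun (h.addHom_ext (f := D.counit.comp (AddMonoidHom.mulLeft (D.source r)))
    (f' := (AddMonoidHom.mulLeft r).comp D.counit) fun r' s σ => ?_) c
  simp only [AddMonoidHom.comp_apply, AddMonoidHom.coe_mulLeft]
  rw [← mul_assoc, ← mul_assoc, ← map_mul, h.counit_gen, h.counit_gen, mul_assoc]

theorem counit_target_mul (h : D.IsSpannedByGrouplikes act g) (r : R) (c : C) :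
    D.counit (D.target (op r) * c) = D.counit c * r := by
  refine DFunLike.congr_fun (h.addHom_ext (f := D.counit.comp
    (AddMonoidHom.mulLeft (D.target (op r))))
    (f' := (AddMonoidHom.mulRight r).comp D.counit) fun r' s σ => ?_) c
  simp only [AddMonoidHom.comp_apply, AddMonoidHom.coe_mulLeft, AddMonoidHom.mulRight_apply]
  rw [← mul_assoc, ← mul_assoc, ← D.commute, mul_assoc (D.source r'), ← map_mul,
    ← MulOpposite.op_mul, h.counit_gen, h.counit_gen, mul_assoc]

theorem counit_grouplike_mul (h : D.IsSpannedByGrouplikes act g) (σ : G) (c : C) :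
    D.counit (g σ * c) = act σ (D.counit c) := by
  refine DFunLike.congr_fun (h.addHom_ext (f := D.counit.comp (AddMonoidHom.mulLeft (g σ)))
    (f' := (act σ).toAddMonoidHom.comp D.counit) fun r s τ => ?_) c
  simp only [AddMonoidHom.comp_apply, AddMonoidHom.coe_mulLeft]
  rw [← mul_assoc, ← mul_assoc, h.mul_source, mul_assoc (D.source _), h.mul_target, h.counit_gen,
    ← mul_assoc, mul_assoc, ← h.grouplike_mul, h.counit_gen]
  exact (map_mul (act σ) r s).symm

/-- The coproduct is multiplicative because left multiplication by each of `source r`, `target s`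
and `g σ` corresponds to an operator on `C ⊗_R C` that is compatible with the coproduct. -/
theorem comul_mul (h : D.IsSpannedByGrouplikes act g) (c d : C) {n m : ℕ} (a b : Fin n → C)
    (a' b' : Fin m → C) (hc : D.Sweedler c a b) (hd : D.Sweedler d a' b') :
    D.comul (c * d) = ∑ i, ∑ j, D.tmul (a i * a' j) (b i * b' j) := by
  have e : D.comul.comp (AddMonoidHom.mulRight d) =
      (∑ j, (D.mulSnd (b' j)).comp (D.mulFst (a' j))).comp D.comul := by
    refine h.addHom_ext fun r s σ => ?_
    simp only [AddMonoidHom.comp_apply, AddMonoidHom.mulRight_apply, AddMonoidHom.finsetSum_apply]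
    rw [h.comul_gen, mul_assoc, mul_assoc, h.comul_source_mul, h.comul_target_mul,
      h.comul_grouplike_mul, hd, map_sum, map_sum, map_sum]
    refine Finset.sum_congr rfl fun j _ => ?_
    rw [SourceTarget.mulFst_tmul, SourceTarget.mulSnd_tmul, mul_assoc, mul_assoc]
    rfl
  have e' := DFunLike.congr_fun e c
  simp only [AddMonoidHom.comp_apply, AddMonoidHom.mulRight_apply,
    AddMonoidHom.finsetSum_apply] at e'
  rw [e', Finset.sum_comm, hc]
  refine Finset.sum_congr rfl fun j _ => ?_
  rw [map_sum, map_sum]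
  rfl

theorem takeuchi (h : D.IsSpannedByGrouplikes act g) (r : R) (c : C) :
    D.mulFst (D.target (op r)) (D.comul c) = D.mulSnd (D.source r) (D.comul c) := by
  refine DFunLike.congr_fun (h.addHom_ext (f := (D.mulFst (D.target (op r))).comp D.comul)
    (f' := (D.mulSnd (D.source r)).comp D.comul) fun r' s σ => ?_) c
  simp only [AddMonoidHom.comp_apply]
  rw [h.comul_gen, SourceTarget.mulFst_tmul, SourceTarget.mulSnd_tmul, mul_assoc, h.mul_target,
    ← mul_assoc, D.commute, mul_assoc, D.tmul_balanced, mul_assoc, h.mul_source, ← mul_assoc,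
    D.commute, mul_assoc]

/-- The map `a ⊗ b ↦ Δ(a) ⊗ b`. -/
def comulFst (h : D.IsSpannedByGrouplikes act g) : D.Tens →+ D.Tens₃ :=
  BalTens.lift ((BalTens.tmul _ _).comp D.comul) fun r a b => by
    simp only [AddMonoidHom.comp_apply]
    rw [h.comul_target_mul]
    exact D.glueRight_balanced r _ b

/-- The map `a ⊗ b ↦ a ⊗ Δ(b)`. -/
def comulSnd (h : D.IsSpannedByGrouplikes act g) : D.Tens →+ D.Tens₃ :=
  BalTens.lift (AddMonoidHom.mk' (fun a => (D.glueLeft a).comp D.comul) fun a a' => by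
      rw [D.glueLeft_add]; rfl) fun r a b => by
    simp only [AddMonoidHom.mk'_apply, AddMonoidHom.comp_apply]
    rw [D.glueLeft_target_mul, h.comul_source_mul]

theorem comulFst_comul (h : D.IsSpannedByGrouplikes act g) (c : C) :
    h.comulFst (D.comul c) = h.comulSnd (D.comul c) := by
  refine DFunLike.congr_fun (h.addHom_ext (f := h.comulFst.comp D.comul)
    (f' := h.comulSnd.comp D.comul) fun r s σ => ?_) c
  simp only [AddMonoidHom.comp_apply]
  rw [h.comul_gen]
  change D.glueRight (D.comul (D.source r * g σ)) (D.target (op s) * g σ) =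
    D.glueLeft (D.source r * g σ) (D.comul (D.target (op s) * g σ))
  have e1 := h.comul_gen r 1 σ
  have e2 := h.comul_gen 1 s σ
  simp only [MulOpposite.op_one, map_one, one_mul, mul_one] at e1 e2
  rw [e1, e2]
  rfl

theorem counit_left (h : D.IsSpannedByGrouplikes act g) (c : C) {n : ℕ} (a b : Fin n → C)
    (hc : D.Sweedler c a b) : ∑ i, D.source (D.counit (a i)) * b i = c := by
  let F : D.Tens →+ C := BalTens.lift
    (AddMonoidHom.mul.comp (D.source.toAddMonoidHom.comp D.counit)) fun r a b => by
      change D.source (D.counit (D.target (op r) * a)) * b =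
        D.source (D.counit a) * (D.source r * b)
      rw [h.counit_target_mul, map_mul, mul_assoc]
  have e : F.comp D.comul = AddMonoidHom.id C := h.addHom_ext fun r s σ => by
    have e1 := h.counit_gen r 1 σ
    simp only [MulOpposite.op_one, map_one, mul_one] at e1
    rw [AddMonoidHom.comp_apply, h.comul_gen]
    change D.source (D.counit (D.source r * g σ)) * (D.target (op s) * g σ) = _
    rw [e1, mul_assoc]
    rfl
  have e' := DFunLike.congr_fun e c
  rw [AddMonoidHom.comp_apply, hc, map_sum] at e'
  exact e'

theorem counit_right (h : D.IsSpannedByGrouplikes act g) (c : C) {n : ℕ} (a b : Fin n → C)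
    (hc : D.Sweedler c a b) : ∑ i, D.target (op (D.counit (b i))) * a i = c := by
  let F : D.Tens →+ C := BalTens.lift ((AddMonoidHom.mul.comp (D.target.toAddMonoidHom.comp
      (MulOpposite.opAddEquiv.toAddMonoidHom.comp D.counit))).flip) fun r a b => by
      change D.target (op (D.counit b)) * (D.target (op r) * a) =
        D.target (op (D.counit (D.source r * b))) * a
      rw [h.counit_source_mul, MulOpposite.op_mul, map_mul, mul_assoc]
  have e : F.comp D.comul = AddMonoidHom.id C := h.addHom_ext fun r s σ => by
    have e1 := h.counit_gen 1 s σ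
    simp only [map_one, one_mul] at e1
    rw [AddMonoidHom.comp_apply, h.comul_gen]
    change D.target (op (D.counit (D.target (op s) * g σ))) * (D.source r * g σ) = _
    rw [e1, ← mul_assoc, ← D.commute]
    rfl
  have e' := DFunLike.congr_fun e c
  rw [AddMonoidHom.comp_apply, hc, map_sum] at e'
  exact e'

theorem counit_mul (h : D.IsSpannedByGrouplikes act g) (c d d' : C)
    (hd : D.counit d = D.counit d') : D.counit (c * d) = D.counit (c * d') := by
  refine DFunLike.congr_fun (h.addHom_ext (f := D.counit.comp (AddMonoidHom.mulRight d))
    (f' := D.counit.comp (AddMonoidHom.mulRight d')) fun r s σ => ?_) c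
  simp only [AddMonoidHom.comp_apply, AddMonoidHom.mulRight_apply]
  rw [mul_assoc, mul_assoc, mul_assoc, mul_assoc, h.counit_source_mul, h.counit_source_mul,
    h.counit_target_mul, h.counit_target_mul, h.counit_grouplike_mul, h.counit_grouplike_mul, hd]

theorem counit_one (h : D.IsSpannedByGrouplikes act g) : D.counit 1 = 1 := by
  simpa [h.grouplike_one] using h.counit_gen 1 1 1

theorem isLeftBialgebroid (h : D.IsSpannedByGrouplikes act g) : D.IsLeftBialgebroid where
  comul_source r c n a b hc := by
    rw [h.comul_source_mul, hc, map_sum]; rfl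
  comul_target r c n a b hc := by
    rw [h.comul_target_mul, hc, map_sum]; rfl
  counit_source := h.counit_source_mul
  counit_target := h.counit_target_mul
  coassoc c n a b hc := by
    have e := h.comulFst_comul c
    rw [hc, map_sum, map_sum] at e
    exact e
  counit_left c n a b := h.counit_left c a b
  counit_right c n a b := h.counit_right c a b
  counit_one := h.counit_one
  comul_one := by simpa [h.grouplike_one] using h.comul_gen 1 1 1
  takeuchi r c n a b hc := by
    have e := h.takeuchi r c
    rw [hc, map_sum, map_sum] at e
    exact e
  comul_mul c d n m a b a' b' := h.comul_mul c d a b a' b'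
  counit_mul_source c d := h.counit_mul c _ _ <| by
    rw [← mul_one (D.source _), h.counit_source_mul, h.counit_one, mul_one]
  counit_mul_target c d := h.counit_mul c _ _ <| by
    rw [← mul_one (D.target _), h.counit_target_mul, h.counit_one, one_mul]

end IsSpannedByGrouplikes

/-! ### Antipodes -/

/-- The antipode identities need only be checked additively: in a left bialgebroid, an
anti-automorphism `τ` with `τ ∘ target = source` makes both `a ⊗ b ↦ τ⁻¹(b)₁ ⊗ τ⁻¹(b)₂ a` and
`a ⊗ b ↦ τ(a)₁ b ⊗ τ(a)₂` well defined on `C ⊗_R C`. -/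
theorem IsSpannedByGrouplikes.isAntipode {G : Type*} [Monoid G] {act : G → R →+* R} {g : G → C}
    (h : D.IsSpannedByGrouplikes act g) (τ : C ≃+ C) (map_mul : ∀ c d, τ (c * d) = τ d * τ c)
    (map_target : ∀ r, τ (D.target (op r)) = D.source r)
    (antipode_inv : ∀ r s σ, D.mulSnd (D.source r * g σ) (D.comul (τ.symm (D.target (op s) * g σ)))
      = D.tmul (τ.symm (D.source r * D.target (op s) * g σ)) 1)
    (antipode : ∀ r s σ, D.mulFst (D.target (op s) * g σ) (D.comul (τ (D.source r * g σ)))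
      = D.tmul 1 (τ (D.source r * D.target (op s) * g σ))) : D.IsAntipode τ where
  map_mul := map_mul
  map_target := map_target
  antipode_inv c n a b hc := by
    let F : D.Tens →+ D.Tens := BalTens.lift
      (AddMonoidHom.mk' (fun a => (D.mulSnd a).comp (D.comul.comp τ.symm.toAddMonoidHom))
        fun a a' => by rw [D.mulSnd_add]; rfl) fun r a b => by
        change D.mulSnd (D.target (op r) * a) (D.comul (τ.symm b)) =
          D.mulSnd a (D.comul (τ.symm (D.source r * b)))
        have e : τ.symm (D.source r * b) = τ.symm b * D.target (op r) := by
          rw [AddEquiv.symm_apply_eq, map_mul, map_target, AddEquiv.apply_symm_apply]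
        rw [e, h.isLeftBialgebroid.comul_mul_target, D.mulSnd_mul]
    have e : F.comp D.comul = ((BalTens.tmul _ _).flip 1).comp τ.symm.toAddMonoidHom :=
      h.addHom_ext fun r s σ => by
        rw [AddMonoidHom.comp_apply, h.comul_gen]
        exact antipode_inv r s σ
    have e' := DFunLike.congr_fun e c
    rw [AddMonoidHom.comp_apply, hc, map_sum] at e'
    exact e'
  antipode c n a b hc := by
    let F : D.Tens →+ D.Tens := BalTens.lift
      (AddMonoidHom.flip (AddMonoidHom.mk'
        (fun b => (D.mulFst b).comp (D.comul.comp τ.toAddMonoidHom))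
        fun a a' => by rw [D.mulFst_add]; rfl)) fun r a b => by
        change D.mulFst b (D.comul (τ (D.target (op r) * a))) =
          D.mulFst (D.source r * b) (D.comul (τ a))
        rw [map_mul, map_target, h.isLeftBialgebroid.comul_mul_source, D.mulFst_mul]
    have e : F.comp D.comul = ((BalTens.tmul _ _) 1).comp τ.toAddMonoidHom :=
      h.addHom_ext fun r s σ => by
        rw [AddMonoidHom.comp_apply, h.comul_gen]
        exact antipode r s σ
    have e' := DFunLike.congr_fun e c
    rw [AddMonoidHom.comp_apply, hc, map_sum] at e'
    exact e'

/-- Transport of an antipode along an isomorphism of bialgebroids. -/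
theorem isAntipode_conj {τ : C ≃+ C} (hτ : D.IsAntipode τ) (Ψ : C ≃+* C')
    (hΨ : IsBialgebroidHom D D' (Ψ : C →+* C')) :
    D'.IsAntipode ((Ψ.symm.toAddEquiv.trans τ).trans Ψ.toAddEquiv) := by
  have hs : ∀ r, Ψ (D.source r) = D'.source r := hΨ.map_source
  have ht : ∀ r, Ψ (D.target r) = D'.target r := hΨ.map_target
  let F : D.Tens →+ D'.Tens := D.mapTens D'.toSourceTarget id Ψ.toAddEquiv.toAddMonoidHom
    Ψ.toAddEquiv.toAddMonoidHom (fun r c => by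
      change Ψ (D.target (op r) * c) = D'.target (op r) * Ψ c
      rw [map_mul, ht]) (fun r c => by
      change Ψ (D.source r * c) = D'.source r * Ψ c
      rw [map_mul, hs])
  let F' : D'.Tens →+ D.Tens := D'.mapTens D.toSourceTarget id Ψ.symm.toAddEquiv.toAddMonoidHom
    Ψ.symm.toAddEquiv.toAddMonoidHom (fun r c => by
      change Ψ.symm (D'.target (op r) * c) = D.target (op r) * Ψ.symm c
      rw [map_mul, ← ht, RingEquiv.symm_apply_apply]) (fun r c => by
      change Ψ.symm (D'.source r * c) = D.source r * Ψ.symm c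
      rw [map_mul, ← hs, RingEquiv.symm_apply_apply])
  have hF : ∀ a b, F (D.tmul a b) = D'.tmul (Ψ a) (Ψ b) := fun _ _ => rfl
  have hFF : ∀ w, F' (F w) = w := fun w => by
    induction w using BalTens.induction_on with
    | zero => simp only [map_zero]
    | tmul a b =>
      change D.tmul (Ψ.symm (Ψ a)) (Ψ.symm (Ψ b)) = D.tmul a b
      rw [RingEquiv.symm_apply_apply, RingEquiv.symm_apply_apply]
    | add v w hv hw => rw [map_add, map_add, hv, hw]
  have hcomul : ∀ c, D'.comul (Ψ c) = F (D.comul c) := fun c => by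
    obtain ⟨n, a, b, hc⟩ := D.exists_sweedler c
    rw [hc, map_sum]
    exact hΨ.map_comul c a b hc
  have hfst : ∀ c w, F (D.mulFst c w) = D'.mulFst (Ψ c) (F w) := fun c w => by
    induction w using BalTens.induction_on with
    | zero => simp only [map_zero]
    | tmul a b =>
      change D'.tmul (Ψ (a * c)) (Ψ b) = D'.tmul (Ψ a * Ψ c) (Ψ b)
      rw [map_mul]
    | add v w hv hw => simp only [map_add, hv, hw]
  have hsnd : ∀ c w, F (D.mulSnd c w) = D'.mulSnd (Ψ c) (F w) := fun c w => by
    induction w using BalTens.induction_on with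
    | zero => simp only [map_zero]
    | tmul a b =>
      change D'.tmul (Ψ a) (Ψ (b * c)) = D'.tmul (Ψ a) (Ψ b * Ψ c)
      rw [map_mul]
    | add v w hv hw => simp only [map_add, hv, hw]
  -- As `F'` is a left inverse of `F = Ψ ⊗ Ψ`, every presentation of a coproduct in `C'` comes from
  -- one in `C`.
  have hSw : ∀ (c : C') {n : ℕ} (a b : Fin n → C'), D'.Sweedler c a b →
      D.Sweedler (Ψ.symm c) (fun i => Ψ.symm (a i)) (fun i => Ψ.symm (b i)) := by
    intro c n a b hc
    have e : F (D.comul (Ψ.symm c)) = D'.comul c := by rw [← hcomul, RingEquiv.apply_symm_apply]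
    rw [Sweedler, ← hFF (D.comul _), e, hc, map_sum]
    rfl
  have happ : ∀ c, ((Ψ.symm.toAddEquiv.trans τ).trans Ψ.toAddEquiv) c = Ψ (τ (Ψ.symm c)) :=
    fun _ => rfl
  refine ⟨fun c d => ?_, fun r => ?_, fun c n a b hc => ?_, fun c n a b hc => ?_⟩
  · simp only [happ, map_mul, hτ.map_mul]
  · rw [happ, ← ht, RingEquiv.symm_apply_apply, hτ.map_target, hs]
  · have e := congrArg F (hτ.antipode_inv _ _ _ (hSw c a b hc))
    simp only [map_sum, hsnd, hF, ← hcomul, RingEquiv.apply_symm_apply, map_one] at e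
    exact e
  · have e := congrArg F (hτ.antipode _ _ _ (hSw c a b hc))
    simp only [map_sum, hfst, hF, ← hcomul, RingEquiv.apply_symm_apply, map_one] at e
    exact e

end BialgebroidData

/-! ### The enveloping algebra and its crossed product -/

section Enveloping

variable (k R : Type*) [CommRing k] [Ring R] [Algebra k R]

theorem envData_source (r : R) : (envData k R).source r = r ⊗ₜ[k] (1 : Rᵐᵒᵖ) := rfl

theorem envData_target (r : Rᵐᵒᵖ) : (envData k R).target r = (1 : R) ⊗ₜ[k] r := rfl

/-- The only grouplike element needed to span `R^e` is `1`. -/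
theorem envData_isSpannedByGrouplikes : (envData k R).IsSpannedByGrouplikes
    (fun _ : Unit => RingHom.id R) (fun _ => 1) where
  span := by
    refine (AddSubgroup.eq_top_iff' _).2 fun p => ?_
    induction p with
    | zero => exact zero_mem _
    | tmul r s =>
      refine AddSubgroup.subset_closure ⟨r, unop s, (), ?_⟩
      rw [mul_one, envData_source, envData_target, Algebra.TensorProduct.tmul_mul_tmul, one_mul,
        mul_one, MulOpposite.op_unop]
    | add p q hp hq => exact add_mem hp hq
  comul_gen r s _ := by
    rw [mul_one, mul_one, mul_one, envData_source, envData_target,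
      Algebra.TensorProduct.tmul_mul_tmul, one_mul, mul_one, envData_comul_tmul]
  counit_gen r s _ := by
    rw [mul_one, envData_source, envData_target, Algebra.TensorProduct.tmul_mul_tmul, one_mul,
      mul_one, envData_counit_tmul]
  grouplike_one := rfl
  grouplike_mul _ _ := (mul_one 1).symm
  mul_source _ r := by rw [one_mul, mul_one]; rfl
  mul_target _ r := by rw [one_mul, mul_one]; rfl

theorem envTwist_symm_tmul (r s : R) : (envTwist k R).symm (r ⊗ₜ[k] op s) = s ⊗ₜ[k] op r := by
  rw [AddEquiv.symm_apply_eq, envTwist_tmul]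

theorem envTwist_mul (p q : R ⊗[k] Rᵐᵒᵖ) :
    envTwist k R (p * q) = envTwist k R q * envTwist k R p := by
  induction p with
  | zero => simp only [zero_mul, mul_zero, map_zero]
  | tmul r s =>
    induction q with
    | zero => simp only [zero_mul, mul_zero, map_zero]
    | tmul u v =>
      obtain ⟨s, rfl⟩ := MulOpposite.op_surjective s
      obtain ⟨v, rfl⟩ := MulOpposite.op_surjective v
      rw [Algebra.TensorProduct.tmul_mul_tmul, ← MulOpposite.op_mul, envTwist_tmul, envTwist_tmul,
        envTwist_tmul, Algebra.TensorProduct.tmul_mul_tmul, ← MulOpposite.op_mul]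
    | add p q hp hq => simp only [mul_add, add_mul, map_add, hp, hq]
  | add p q hp hq => simp only [mul_add, add_mul, map_add, hp, hq]

theorem envTwist_isAntipode : (envData k R).IsAntipode (envTwist k R) := by
  refine (envData_isSpannedByGrouplikes k R).isAntipode (envTwist k R) (envTwist_mul k R)
    (fun r => rfl) (fun r s _ => ?_) (fun r s _ => ?_)
  · rw [mul_one, mul_one, mul_one, envData_source, envData_target,
      Algebra.TensorProduct.tmul_mul_tmul, one_mul, mul_one, envTwist_symm_tmul,
      envTwist_symm_tmul, envData_comul_tmul, SourceTarget.mulSnd_tmul]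
    have h := (envData k R).tmul_balanced r (s ⊗ₜ[k] 1) 1
    rw [envData_source, envData_target, Algebra.TensorProduct.tmul_mul_tmul, one_mul, mul_one,
      mul_one] at h
    rw [h, MulOpposite.op_one, ← Algebra.TensorProduct.one_def, one_mul]
  · rw [mul_one, mul_one, mul_one, envData_source, envData_target,
      Algebra.TensorProduct.tmul_mul_tmul, one_mul, mul_one, envTwist_tmul, ← MulOpposite.op_one,
      envTwist_tmul, envData_comul_tmul, SourceTarget.mulFst_tmul]
    have h := (envData k R).tmul_balanced s 1 (1 ⊗ₜ[k] op r)
    rw [envData_source, envData_target, Algebra.TensorProduct.tmul_mul_tmul, one_mul, mul_one,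
      mul_one] at h
    rw [← Algebra.TensorProduct.one_def, one_mul, h]

end Enveloping

namespace Bowtie

variable (K R G : Type*) [CommRing K] [Ring R] [Algebra K R] [Group G] [MulSemiringAction G R]
  [SMulCommClass G K R]

variable {K R G} in
theorem source_mul_target_mul_mk (r s : R) (σ : G) :
    (data K R G).source r * (data K R G).target (op s) * mk σ 1 =
      mk σ (r ⊗ₜ[K] op (σ⁻¹ • s)) := by
  change mk 1 (r ⊗ₜ[K] op 1) * mk 1 (1 ⊗ₜ[K] op s) * mk σ (1 ⊗ₜ[K] op 1) = _
  rw [mk_tmul_mul_mk_tmul, mk_tmul_mul_mk_tmul]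
  simp

variable {K R G} in
@[elab_as_elim] theorem induction_on {p : Bowtie K R G → Prop} (x : Bowtie K R G) (zero : p 0)
    (mk : ∀ σ r s, p (mk σ (r ⊗ₜ[K] op s))) (add : ∀ x y, p x → p y → p (x + y)) : p x := by
  induction x using Finsupp.induction_linear with
  | zero => exact zero
  | add f g hf hg => exact add f g hf hg
  | single σ w =>
    change p (Bowtie.mk σ w)
    induction w with
    | zero => rw [map_zero]; exact zero
    | tmul r s => exact mk σ r (unop s)
    | add v w hv hw => rw [map_add]; exact add _ _ hv hw

theorem data_isSpannedByGrouplikes : (data K R G).IsSpannedByGrouplikes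
    (fun σ : G => MulSemiringAction.toRingHom G R σ) (fun σ => mk σ 1) where
  span := by
    refine (AddSubgroup.eq_top_iff' _).2 fun x => ?_
    induction x using induction_on with
    | zero => exact zero_mem _
    | mk σ r s =>
      refine AddSubgroup.subset_closure ⟨r, σ • s, σ, ?_⟩
      rw [source_mul_target_mul_mk, inv_smul_smul]
    | add x y hx hy => exact add_mem hx hy
  comul_gen r s σ := by
    have h1 := source_mul_target_mul_mk (K := K) r 1 σ
    have h2 := source_mul_target_mul_mk (K := K) 1 s σ
    simp only [MulOpposite.op_one, map_one, one_mul, mul_one, smul_one] at h1 h2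
    rw [source_mul_target_mul_mk, data_comul, h1, h2]
  counit_gen r s σ := by rw [source_mul_target_mul_mk, data_counit, smul_inv_smul]
  grouplike_one := rfl
  grouplike_mul σ τ := by rw [mk_mul_mk, map_one (actR τ), map_one (actL σ), one_mul]
  mul_source σ r := by
    change mk σ (1 ⊗ₜ[K] op 1) * mk 1 (r ⊗ₜ[K] op 1) = mk 1 ((σ • r) ⊗ₜ[K] op 1) *
      mk σ (1 ⊗ₜ[K] op 1)
    rw [mk_tmul_mul_mk_tmul, mk_tmul_mul_mk_tmul]
    simp
  mul_target σ r := by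
    change mk σ (1 ⊗ₜ[K] op 1) * mk 1 (1 ⊗ₜ[K] op r) = mk 1 (1 ⊗ₜ[K] op (σ • r)) *
      mk σ (1 ⊗ₜ[K] op 1)
    rw [mk_tmul_mul_mk_tmul, mk_tmul_mul_mk_tmul]
    simp

end Bowtie

/-! ### The bialgebroid of bimodule endomorphisms -/

section Extensions

variable {K A B : Type*} [CommRing K] [Ring A] [Algebra K A] [Ring B] [Algebra K B]
  (ι : B →ₐ[K] A)

namespace TensSq

variable {ι}

theorem lmul_tmul (a x y : A) : lmul ι a (tmul ι x y) = tmul ι (a * x) y := rfl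

theorem rmul_tmul (a x y : A) : rmul ι a (tmul ι x y) = tmul ι x (y * a) := rfl

end TensSq

namespace BimodEnd

/-- Evaluation at `y ∈ A`. -/
def evalHom (y : A) : BimodEnd ι →+ A := AddMonoidHom.mk' (fun α => α.1 y) fun _ _ => rfl

theorem lam_mul_evalAt (r : Cent ι) (α : BimodEnd ι) (x : A) (t : TensSq ι) :
    evalAt ι (lam ι r * α) x t = r * evalAt ι α x t := by
  induction t using BalTens.induction_on with
  | zero => simp only [map_zero, mul_zero]
  | tmul y z => exact mul_assoc _ _ _
  | add v w hv hw => rw [map_add, map_add, hv, hw, mul_add]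

theorem evalAt_one_mem_cent (α : BimodEnd ι) {t : TensSq ι}
    (ht : ∀ b, TensSq.lmul ι (ι b) t = TensSq.rmul ι (ι b) t) : evalAt ι α 1 t ∈ Cent ι := by
  refine (mem_cent ι).2 fun b => ?_
  rw [← evalAt_mul_left, mul_one, ← evalAt_rmul, ← ht, ← evalAt_mul_right, one_mul]

end BimodEnd

namespace LeftD2QuasiBasis

variable {ι} (q : LeftD2QuasiBasis ι)

/-- The coefficient `α(t_i¹) t_i² ∈ R` of `α ∈ 𝒮` with respect to `β_i`. -/
def coeff (i : Fin q.n) : BimodEnd ι →+ Cent ι :=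
  AddMonoidHom.mk' (fun α => ⟨BimodEnd.evalAt ι α 1 (q.t i),
    BimodEnd.evalAt_one_mem_cent ι α (q.central i)⟩) fun α β =>
    Subtype.ext (BimodEnd.add_evalAt ι α β 1 (q.t i))

theorem sum_evalAt_mul (α : BimodEnd ι) (x y z : A) :
    ∑ i, BimodEnd.evalAt ι α x (q.t i) * ((q.β i).1 y * z) = α.1 (x * y) * z := by
  have h := congrArg (BimodEnd.evalAt ι α x) (q.sum_eq y z)
  rw [BimodEnd.evalAt_tmul] at h
  simpa only [map_sum, BimodEnd.evalAt_rmul] using h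

theorem sum_coeff_mul (α : BimodEnd ι) : ∑ i, BimodEnd.lam ι (q.coeff i α) * q.β i = α := by
  ext x
  have h := q.sum_evalAt_mul α 1 x 1
  simp only [mul_one, one_mul] at h
  rw [← h, AddSubmonoidClass.coe_finsetSum, LinearMap.sum_apply]
  rfl

theorem coeff_lam_mul (i : Fin q.n) (r : Cent ι) (α : BimodEnd ι) :
    q.coeff i (BimodEnd.lam ι r * α) = r * q.coeff i α :=
  Subtype.ext (BimodEnd.lam_mul_evalAt ι r α 1 (q.t i))

end LeftD2QuasiBasis

namespace BimodEnd

section Pairing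

variable {ι} {M : Type*} [AddCommGroup M] {actR : Cent ι → M → M}

/-- For a right `R`-module map `P : M → A`, the map `m ⊗ β ↦ P(m) β(y)` on `M ⊗_R 𝒮`. -/
def pairWith (P : M →+ A) (hP : ∀ r m, P (actR r m) = P m * r) (y : A) :
    BalTens actR (fun (r : Cent ι) (c : BimodEnd ι) => (sourceTarget ι).source r * c) →+ A :=
  BalTens.lift ((AddMonoidHom.mul.comp P).compl₂ (evalHom ι y)) <| by
    intro r m β
    change P (actR r m) * β.1 y = P m * (r * β.1 y)
    rw [hP, mul_assoc]

/-- As `𝒮` is spanned over `R` by the `β_i` with `R`-linear coefficients `β ↦ β(t_i¹) t_i²`, an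
element of `M ⊗_R 𝒮` is determined by the values `P(m) β(y)`, provided that the maps `P`
separate the points of `M`. -/
theorem pairWith_separates (q : LeftD2QuasiBasis ι) {X : Type*} (P : X → M →+ A)
    (hP : ∀ x r m, P x (actR r m) = P x m * r)
    (add_act : ∀ r s m, actR (r + s) m = actR r m + actR s m)
    (act_add : ∀ r m m', actR r (m + m') = actR r m + actR r m')
    (mul_act : ∀ r s m, actR (r * s) m = actR s (actR r m))
    (hsep : ∀ m m', (∀ x, P x m = P x m') → m = m')
    {w w' : BalTens actR (fun (r : Cent ι) (c : BimodEnd ι) => (sourceTarget ι).source r * c)}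
    (h : ∀ x y, pairWith (P x) (hP x) y w = pairWith (P x) (hP x) y w') : w = w' := by
  let act : M →+ Cent ι →+ M := AddMonoidHom.mk' (fun m => AddMonoidHom.mk' (fun r => actR r m)
    fun r s => add_act r s m) fun m m' => by ext r; exact act_add r m m'
  let Φ : Fin q.n →
      BalTens actR (fun (r : Cent ι) (c : BimodEnd ι) => (sourceTarget ι).source r * c) →+ M :=
    fun i => BalTens.lift (act.compl₂ (q.coeff i)) fun r m β => by
      change actR (q.coeff i β) (actR r m) = actR (q.coeff i (lam ι r * β)) m
      rw [q.coeff_lam_mul, mul_act]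
  have hΦ : ∀ w, ∑ i, BalTens.tmul _ _ (Φ i w) (q.β i) = w := fun w => by
    induction w using BalTens.induction_on with
    | zero => simp only [map_zero, AddMonoidHom.zero_apply, Finset.sum_const_zero]
    | tmul m β =>
      have e : ∀ i, BalTens.tmul actR
          (fun (r : Cent ι) (c : BimodEnd ι) => (sourceTarget ι).source r * c)
          (Φ i (BalTens.tmul _ _ m β)) (q.β i) =
          BalTens.tmul _ _ m (lam ι (q.coeff i β) * q.β i) := fun i =>
        BalTens.tmul_balanced (actR := actR)
          (actL := fun (r : Cent ι) (c : BimodEnd ι) => (sourceTarget ι).source r * c)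
          (q.coeff i β) m (q.β i)
      rw [Finset.sum_congr rfl fun i _ => e i, ← map_sum, q.sum_coeff_mul]
    | add v w hv hw =>
      simp only [map_add, AddMonoidHom.add_apply, Finset.sum_add_distrib, hv, hw]
  -- `T x` sends `m ⊗ β` to the map `t ↦ P x m * β(t¹) t²`; it interpolates between the values at
  -- pure tensors, which are known, and those at the `t_i`, which give the coefficients `Φ i`.
  let T : X → BalTens actR (fun (r : Cent ι) (c : BimodEnd ι) => (sourceTarget ι).source r * c) →+
      TensSq ι →+ A := fun x => BalTens.lift
    (AddMonoidHom.mk' (fun m => AddMonoidHom.mk'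
      (fun β => (AddMonoidHom.mulLeft (P x m)).comp (evalAt ι β 1)) fun β β' => by
        ext t
        change P x m * evalAt ι (β + β') 1 t = P x m * evalAt ι β 1 t + P x m * evalAt ι β' 1 t
        rw [add_evalAt, mul_add]) fun m m' => by
        ext β t
        change P x (m + m') * evalAt ι β 1 t = P x m * evalAt ι β 1 t + P x m' * evalAt ι β 1 t
        rw [map_add, add_mul]) fun r m β => by
      ext t
      change P x (actR r m) * evalAt ι β 1 t = P x m * evalAt ι (lam ι r * β) 1 t
      rw [hP, lam_mul_evalAt, mul_assoc]
  have hT : ∀ x w i, P x (Φ i w) = T x w (q.t i) := fun x w i => by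
    induction w using BalTens.induction_on with
    | zero => simp only [map_zero, AddMonoidHom.zero_apply]
    | tmul m β => exact hP x _ m
    | add v w hv hw => simp only [map_add, AddMonoidHom.add_apply, hv, hw]
  have hT' : ∀ x w y z, T x w (TensSq.tmul ι y z) = pairWith (P x) (hP x) y w * z :=
    fun x w y z => by
    induction w using BalTens.induction_on with
    | zero => simp only [map_zero, AddMonoidHom.zero_apply, zero_mul]
    | tmul m β =>
      change P x m * (β.1 (1 * y) * z) = P x m * β.1 y * z
      rw [one_mul, mul_assoc]
    | add v w hv hw => simp only [map_add, AddMonoidHom.add_apply, hv, hw, add_mul]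
  have hTT : ∀ x, T x w = T x w' := fun x => BalTens.addHom_ext fun y z => by
    rw [hT', hT', h]
  rw [← hΦ w, ← hΦ w']
  refine Finset.sum_congr rfl fun i _ => ?_
  rw [hsep (Φ i w) (Φ i w') fun x => by rw [hT, hT, hTT]]

end Pairing

variable {ι} (q : LeftD2QuasiBasis ι)

/-- The map `α ⊗ β ↦ α(x) β(y)` on `𝒮 ⊗_R 𝒮`. -/
def pair (x y : A) : (data ι q).Tens →+ A :=
  pairWith (evalHom ι x) (fun _ _ => rfl) y

theorem pair_tensActR (x y : A) (r : Cent ι) (w : (data ι q).Tens) :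
    pair q x y ((data ι q).tensActR r w) = pair q x y w * r := by
  induction w using BalTens.induction_on with
  | zero => simp only [map_zero, zero_mul]
  | tmul α β => exact (mul_assoc (α.1 x) (β.1 y) r.1).symm
  | add v w hv hw => simp only [map_add, hv, hw, add_mul]

theorem pair_separates {w w' : (data ι q).Tens}
    (h : ∀ x y, pair q x y w = pair q x y w') : w = w' := by
  have hP : ∀ (x : A) (r : Cent ι) (α : BimodEnd ι),
    evalHom ι x ((data ι q).target (op r) * α) = evalHom ι x α * r := fun _ _ _ => rfl
  have hadd : ∀ (r s : Cent ι) (α : BimodEnd ι), (data ι q).target (op (r + s)) * α =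
      (data ι q).target (op r) * α + (data ι q).target (op s) * α := fun r s α => by
    ext x
    exact mul_add (α.1 x) r.1 s.1
  have hmul : ∀ (r s : Cent ι) (α : BimodEnd ι), (data ι q).target (op (r * s)) * α =
      (data ι q).target (op s) * ((data ι q).target (op r) * α) := fun r s α => by
    ext x
    exact (mul_assoc (α.1 x) r.1 s.1).symm
  have hsep : ∀ α β : BimodEnd ι, (∀ x, evalHom ι x α = evalHom ι x β) → α = β := fun α β h => by
    ext x
    exact h x
  have key := pairWith_separates (M := BimodEnd ι)
    (actR := fun (r : Cent ι) (α : BimodEnd ι) => (data ι q).target (op r) * α)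
    q (fun x => evalHom ι x) hP hadd (fun r α β => mul_add _ _ _) hmul hsep (w := w) (w' := w')
  exact key h

/-- The map `α ⊗ β ⊗ γ ↦ α(x) β(y) γ(z)` on `𝒮 ⊗_R 𝒮 ⊗_R 𝒮`. -/
def pair₃ (x y z : A) : (data ι q).Tens₃ →+ A :=
  pairWith (pair q x y) (fun r w => pair_tensActR q x y r w) z

theorem pair₃_glueRight (x y z : A) (w : (data ι q).Tens) (γ : BimodEnd ι) :
    pair₃ q x y z ((data ι q).glueRight w γ) = pair q x y w * γ.1 z := rfl

theorem pair₃_glueLeft (x y z : A) (α : BimodEnd ι) (w : (data ι q).Tens) :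
    pair₃ q x y z ((data ι q).glueLeft α w) = α.1 x * pair q y z w := by
  induction w using BalTens.induction_on with
  | zero => simp only [map_zero, mul_zero]
  | tmul β γ => exact mul_assoc _ _ _
  | add v w hv hw => simp only [map_add, hv, hw, mul_add]

theorem pair₃_separates {w w' : (data ι q).Tens₃}
    (h : ∀ x y z, pair₃ q x y z w = pair₃ q x y z w') : w = w' := by
  refine pairWith_separates (M := (data ι q).Tens)
    (actR := fun r w => (data ι q).tensActR r w) q (fun x : A × A => pair q x.1 x.2)
    (fun x r w => pair_tensActR q x.1 x.2 r w) (fun r s w => ?_) (fun r v w => map_add _ v w)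
    (fun r s w => ?_) (fun _ _ h => pair_separates q fun x y => h (x, y))
    fun x z => h x.1 x.2 z
  · refine pair_separates q fun x y => ?_
    rw [map_add, pair_tensActR, pair_tensActR, pair_tensActR]
    exact mul_add _ _ _
  · refine pair_separates q fun x y => ?_
    rw [pair_tensActR, pair_tensActR, pair_tensActR]
    exact (mul_assoc _ _ _).symm

/-- The coproduct of `𝒮` is dual to the multiplication of `A`. -/
theorem pair_comul (x y : A) (α : BimodEnd ι) : pair q x y ((data ι q).comul α) = α.1 (x * y) := by
  have h := q.sum_evalAt_mul α x y 1
  simp only [mul_one] at h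
  have e : (data ι q).comul α =
    ∑ i, (data ι q).tmul (contract ι (q.t i) (q.central i) α) (q.β i) := rfl
  rw [← h, e, map_sum]
  rfl

theorem data_sweedler_iff (α : BimodEnd ι) {n : ℕ} (a b : Fin n → BimodEnd ι) :
    (data ι q).Sweedler α a b ↔ ∀ x y, ∑ i, (a i).1 x * (b i).1 y = α.1 (x * y) := by
  have e : ∀ x y, pair q x y (∑ i, (data ι q).tmul (a i) (b i)) = ∑ i, (a i).1 x * (b i).1 y :=
    fun x y => map_sum (pair q x y) _ _
  refine ⟨fun h x y => ?_, fun h => pair_separates q fun x y => ?_⟩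
  · rw [← e, ← pair_comul q, ← h]
  · rw [pair_comul, e, h]

/-- For a quasibasis, `𝒮` is a left bialgebroid over `R`: every axiom becomes an identity between
products of values of endomorphisms, which determine the elements of the tensor powers of `𝒮`. -/
theorem data_isLeftBialgebroid : (data ι q).IsLeftBialgebroid where
  comul_source r α n a b h := by
    rw [data_sweedler_iff] at h
    refine (data_sweedler_iff q _ _ _).2 fun x y => ?_
    change ∑ i, r.1 * (a i).1 x * (b i).1 y = r.1 * α.1 (x * y)
    simp only [← h, Finset.mul_sum, mul_assoc]
  comul_target r α n a b h := by
    rw [data_sweedler_iff] at h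
    refine (data_sweedler_iff q _ _ _).2 fun x y => ?_
    change ∑ i, (a i).1 x * ((b i).1 y * r.1) = α.1 (x * y) * r.1
    simp only [← h, Finset.sum_mul, mul_assoc]
  counit_source r α := rfl
  counit_target r α := rfl
  coassoc α n a b h := by
    rw [data_sweedler_iff] at h
    refine pair₃_separates q fun x y z => ?_
    rw [map_sum, map_sum]
    have e1 : ∀ i, pair₃ q x y z ((data ι q).glueRight ((data ι q).comul (a i)) (b i)) =
        (a i).1 (x * y) * (b i).1 z := fun i => by
      rw [pair₃_glueRight, pair_comul]
    have e2 : ∀ i, pair₃ q x y z ((data ι q).glueLeft (a i) ((data ι q).comul (b i))) =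
        (a i).1 x * (b i).1 (y * z) := fun i => by
      rw [pair₃_glueLeft, pair_comul]
    simp only [e1, e2, h, mul_assoc]
  counit_left α n a b h := by
    rw [data_sweedler_iff] at h
    ext x
    rw [AddSubmonoidClass.coe_finsetSum, LinearMap.sum_apply]
    exact (h 1 x).trans (by rw [one_mul])
  counit_right α n a b h := by
    rw [data_sweedler_iff] at h
    ext x
    rw [AddSubmonoidClass.coe_finsetSum, LinearMap.sum_apply]
    exact (h x 1).trans (by rw [mul_one])
  counit_one := rfl
  comul_one := pair_separates q fun x y => by rw [pair_comul]; rfl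
  takeuchi r α n a b h := by
    rw [data_sweedler_iff] at h
    refine pair_separates q fun x y => ?_
    rw [map_sum, map_sum]
    exact (h (x * r) y).trans (by rw [mul_assoc, ← h]; rfl)
  comul_mul α β n m a b a' b' h h' := by
    rw [data_sweedler_iff] at h h'
    refine pair_separates q fun x y => ?_
    simp only [map_sum]
    rw [pair_comul, Finset.sum_comm]
    change α.1 (β.1 (x * y)) = ∑ j, ∑ i, (a i).1 ((a' j).1 x) * (b i).1 ((b' j).1 y)
    simp only [h, ← map_sum, h']
  counit_mul_source α β := Subtype.ext (congrArg α.1 (mul_one _).symm)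
  counit_mul_target α β := Subtype.ext (congrArg α.1 (one_mul _).symm)

/-- A ring homomorphism to `𝒮` that respects source and target is a homomorphism of bialgebroids
if the grouplike elements spanning the domain act on `A` by unital multiplicative maps. -/
theorem isBialgebroidHom_of_grouplikes {C G : Type*} [Ring C] [Monoid G]
    {D : BialgebroidData (Cent ι) C} {act : G → Cent ι →+* Cent ι} {g : G → C}
    (hD : D.IsSpannedByGrouplikes act g) (f : C →+* BimodEnd ι)
    (hs : ∀ r, f (D.source r) = lam ι r) (ht : ∀ r, f (D.target (op r)) = rho ι r)
    (h_one : ∀ σ, (f (g σ)).1 1 = 1)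
    (h_mul : ∀ σ x y, (f (g σ)).1 (x * y) = (f (g σ)).1 x * (f (g σ)).1 y) :
    D.IsBialgebroidHom (data ι q) f where
  map_source := hs
  map_target r := ht (unop r)
  map_counit c := by
    refine DFunLike.congr_fun (hD.addHom_ext (f := (data ι q).counit.comp f.toAddMonoidHom)
      (f' := D.counit) fun r s σ => ?_) c
    rw [hD.counit_gen]
    refine Subtype.ext ?_
    change (f _).1 1 = (r * s : A)
    rw [map_mul, map_mul, hs, ht]
    change r * ((f (g σ)).1 1 * s) = (r * s : A)
    rw [h_one, one_mul]
  map_comul c n a b h := by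
    refine (data_sweedler_iff q _ _ _).2 fun x y => ?_
    let F : D.Tens →+ A := BalTens.lift ((AddMonoidHom.mul.comp ((evalHom ι x).comp
      f.toAddMonoidHom)).compl₂ ((evalHom ι y).comp f.toAddMonoidHom)) fun r a b => by
        change (f (D.target (op r) * a)).1 x * (f b).1 y = (f a).1 x * (f (D.source r * b)).1 y
        rw [map_mul, map_mul, hs, ht]
        exact mul_assoc ((f a).1 x) r.1 ((f b).1 y)
    have e : F.comp D.comul = (evalHom ι (x * y)).comp f.toAddMonoidHom :=
      hD.addHom_ext fun r s σ => by
        rw [AddMonoidHom.comp_apply, hD.comul_gen]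
        change (f (D.source r * g σ)).1 x * (f (D.target (op s) * g σ)).1 y =
          (f (D.source r * D.target (op s) * g σ)).1 (x * y)
        rw [map_mul f (_ * _), map_mul f, map_mul f, map_mul f, hs, ht]
        change r.1 * (f (g σ)).1 x * ((f (g σ)).1 y * s.1) = r.1 * ((f (g σ)).1 (x * y) * s.1)
        rw [h_mul]
        simp only [mul_assoc]
    have e' := DFunLike.congr_fun e c
    rw [AddMonoidHom.comp_apply, h, map_sum] at e'
    exact e'

end BimodEnd

end Extensions

/-! ### H-separable extensions -/

section Extensions

variable {K A B : Type*} [CommRing K] [Ring A] [Algebra K A] [Ring B] [Algebra K B]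
  (ι : B →ₐ[K] A)

namespace TensSq

variable {ι}

theorem rmul_add (a a' : A) (t : TensSq ι) : rmul ι (a + a') t = rmul ι a t + rmul ι a' t := by
  induction t using BalTens.induction_on with
  | zero => simp only [map_zero, add_zero]
  | tmul x y => rw [rmul_tmul, rmul_tmul, rmul_tmul, mul_add]; exact map_add _ _ _
  | add v w hv hw => rw [map_add, map_add, map_add, hv, hw]; abel

/-- `rmul` as an additive map in the ring element. -/
def rmulHom (t : TensSq ι) : A →+ TensSq ι :=
  AddMonoidHom.mk' (fun a => rmul ι a t) fun a a' => rmul_add a a' t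

theorem rmul_mul (a a' : A) (t : TensSq ι) : rmul ι (a * a') t = rmul ι a' (rmul ι a t) := by
  induction t using BalTens.induction_on with
  | zero => simp only [map_zero]
  | tmul x y => rw [rmul_tmul, rmul_tmul, rmul_tmul, mul_assoc]
  | add v w hv hw => simp only [map_add, hv, hw]

theorem lmul_rmul (a a' : A) (t : TensSq ι) :
    lmul ι a (rmul ι a' t) = rmul ι a' (lmul ι a t) := by
  induction t using BalTens.induction_on with
  | zero => simp only [map_zero]
  | tmul x y => rfl
  | add v w hv hw => simp only [map_add, hv, hw]

theorem tmul_mul_range (x y : A) (b : B) : tmul ι (x * ι b) y = tmul ι x (ι b * y) :=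
  BalTens.tmul_balanced (actR := fun (b : B) (x : A) => x * ι b)
    (actL := fun (b : B) (y : A) => ι b * y) b x y

end TensSq

/-- A system of elements `r_i ∈ R` and `e_i ∈ (A ⊗_B A)^A` with `∑ i, r_i e_i = 1 ⊗ 1`, which
exhibits `A ‖ B` as an H-separable extension. -/
structure HSeparabilitySystem where
  n : ℕ
  r : Fin n → Cent ι
  e : Fin n → TensSq ι
  casimir : ∀ i a, TensSq.lmul ι a (e i) = TensSq.rmul ι a (e i)
  sum_eq : ∑ i, TensSq.rmul ι (r i) (e i) = TensSq.tmul ι 1 1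

variable {ι}

/-- The `e_i` are the images of the standard basis of `A ^ N`, and the `r_i` are the coordinates
of `1 ⊗ 1`. -/
theorem IsHSeparable.nonempty_system (h : IsHSeparable ι) : Nonempty (HSeparabilitySystem ι) := by
  obtain ⟨N, -, f, g, hfl, hfr, hgl, hgr, hgf⟩ := h
  have hcas : ∀ i a, TensSq.lmul ι a (g (Pi.single i 1)) = TensSq.rmul ι a (g (Pi.single i 1)) := by
    intro i a
    rw [← hgl, ← hgr]
    congr 1
    ext j
    by_cases hj : j = i
    · subst hj; simp
    · simp [hj]
  refine ⟨⟨N, fun i => ⟨f (TensSq.tmul ι 1 1) i, (mem_cent ι).2 fun b => ?_⟩,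
    fun i => g (Pi.single i 1), hcas, ?_⟩⟩
  · rw [← hfl, ← hfr, TensSq.lmul_tmul, TensSq.rmul_tmul, mul_one, one_mul]
    have hb := TensSq.tmul_mul_range (ι := ι) 1 1 b
    rw [one_mul, mul_one] at hb
    rw [hb]
  · refine Eq.trans ?_ (hgf (TensSq.tmul ι 1 1))
    conv_rhs => rw [← Finset.univ_sum_single (f (TensSq.tmul ι 1 1)), map_sum]
    refine Finset.sum_congr rfl fun i _ => ?_
    rw [← hgr]
    congr 1
    ext j
    by_cases hj : j = i
    · subst hj; simp
    · simp [hj]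

namespace BimodEnd

/-- The map `t ↦ t¹ v t²` is left `A`-linear. -/
theorem evalAt_rho_lmul (v : Cent ι) (a : A) (t : TensSq ι) :
    evalAt ι (rho ι v) 1 (TensSq.lmul ι a t) = a * evalAt ι (rho ι v) 1 t := by
  induction t using BalTens.induction_on with
  | zero => simp only [map_zero, mul_zero]
  | tmul y z =>
    change 1 * (a * y) * v * z = a * (1 * y * v * z)
    simp only [one_mul, mul_assoc]
  | add v w hv hw => simp only [map_add, hv, hw, mul_add]

variable (k : Type*) [CommRing k] [Algebra k (Cent ι)]

/-- The ring homomorphism `r ⊗ s̄ ↦ λ_r ∘ ρ_s` on `R ⊗_k R^op`, for scalars that are central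
in `A`. -/
def envHom (hk : ∀ c : k, (algebraMap k (Cent ι) c : A) ∈ Subalgebra.center K A) :
    (Cent ι ⊗[k] (Cent ι)ᵐᵒᵖ) →+* BimodEnd ι :=
  let φ : (Cent ι ⊗[k] (Cent ι)ᵐᵒᵖ) →+ BimodEnd ι := TensorProduct.liftAddHom
    ((AddMonoidHom.mul.comp (sourceTarget ι).source.toAddMonoidHom).compl₂
      (sourceTarget ι).target.toAddMonoidHom) fun c r s => by
    change lam ι (c • r) * rho ι (unop s) = lam ι r * rho ι (unop (c • s))
    ext x
    change (c • r : Cent ι).1 * (x * (unop s).1) = r.1 * (x * (c • unop s : Cent ι).1)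
    rw [Algebra.smul_def, Algebra.smul_def]
    change (algebraMap k (Cent ι) c : A) * r.1 * (x * (unop s).1) =
      r.1 * (x * ((algebraMap k (Cent ι) c : A) * (unop s).1))
    have h := Subalgebra.mem_center_iff.1 (hk c)
    rw [← mul_assoc x, h x, ← h r.1]
    simp only [mul_assoc]
  have hφ : ∀ r s : Cent ι, φ (r ⊗ₜ[k] op s) = lam ι r * rho ι s := fun _ _ => rfl
  { φ with
    map_one' := by
      change φ (1 ⊗ₜ[k] op 1) = 1
      rw [hφ]
      ext x
      change (1 : A) * (x * 1) = x
      rw [one_mul, mul_one]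
    map_mul' := by
      intro p p'
      change φ (p * p') = φ p * φ p'
      induction p with
      | zero => simp only [zero_mul, map_zero]
      | tmul r s =>
        induction p' with
        | zero => simp only [mul_zero, map_zero]
        | tmul u v =>
          obtain ⟨s, rfl⟩ := MulOpposite.op_surjective s
          obtain ⟨v, rfl⟩ := MulOpposite.op_surjective v
          rw [Algebra.TensorProduct.tmul_mul_tmul, ← MulOpposite.op_mul, hφ, hφ, hφ]
          ext x
          change r.1 * u.1 * (x * (v.1 * s.1)) = r.1 * (u.1 * (x * v.1) * s.1)
          simp only [mul_assoc]
        | add p q hp hq => simp only [map_add, mul_add, hp, hq]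
      | add p q hp hq => simp only [map_add, add_mul, hp, hq] }

variable (hk : ∀ c : k, (algebraMap k (Cent ι) c : A) ∈ Subalgebra.center K A)

theorem envHom_tmul (r s : Cent ι) :
    envHom k hk (r ⊗ₜ[k] op s) = lam ι r * rho ι s := rfl

theorem envHom_isBialgebroidHom (q : LeftD2QuasiBasis ι) :
    (envData k (Cent ι)).IsBialgebroidHom (data ι q) (envHom k hk) := by
  refine isBialgebroidHom_of_grouplikes q (envData_isSpannedByGrouplikes k (Cent ι)) _
    (fun r => ?_) (fun r => ?_) (fun _ => ?_) (fun _ x y => ?_)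
  · rw [envData_source, ← MulOpposite.op_one, envHom_tmul]
    ext x
    exact congrArg (r.1 * ·) (mul_one x)
  · rw [envData_target, envHom_tmul]
    ext x
    exact one_mul _
  · rw [map_one (envHom k hk)]; rfl
  · rw [map_one (envHom k hk)]; rfl

end BimodEnd

namespace HSeparabilitySystem

variable (S : HSeparabilitySystem ι)

theorem sum_rmul (x y : A) : ∑ i, TensSq.rmul ι (x * S.r i * y) (S.e i) = TensSq.tmul ι x y := by
  have h := congrArg (fun t => TensSq.lmul ι x (TensSq.rmul ι y t)) S.sum_eq
  simp only [map_sum, TensSq.rmul_tmul, TensSq.lmul_tmul, one_mul, mul_one] at h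
  rw [← h]
  refine Finset.sum_congr rfl fun i _ => ?_
  rw [TensSq.lmul_rmul, TensSq.lmul_rmul, S.casimir, ← TensSq.rmul_mul, ← TensSq.rmul_mul,
    mul_assoc]

/-- The `e_i` and the right multiplications by the `r_i` form a quasibasis. -/
def quasiBasis : LeftD2QuasiBasis ι where
  n := S.n
  β i := BimodEnd.rho ι (S.r i)
  t := S.e
  central i b := S.casimir i (ι b)
  sum_eq := S.sum_rmul

/-- The map `α ↦ ∑ i, α(e_i¹) e_i² ⊗ r_i`, inverse to `R ⊗_k R^op → 𝒮` when the scalars in `k` are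
the central elements of `A`. -/
def invHom (k : Type*) [CommRing k] [Algebra k (Cent ι)] :
    BimodEnd ι →+ Cent ι ⊗[k] (Cent ι)ᵐᵒᵖ :=
  AddMonoidHom.mk' (fun α => ∑ i, S.quasiBasis.coeff i α ⊗ₜ[k] op (S.r i)) fun α β => by
    simp only [map_add, TensorProduct.add_tmul, Finset.sum_add_distrib]

theorem coeff_rho_mem_center (i : Fin S.n) (v : Cent ι) :
    (S.quasiBasis.coeff i (BimodEnd.rho ι v) : A) ∈ Subalgebra.center K A :=
  Subalgebra.mem_center_iff.2 fun a => by
    change a * BimodEnd.evalAt ι (BimodEnd.rho ι v) 1 (S.e i) =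
      BimodEnd.evalAt ι (BimodEnd.rho ι v) 1 (S.e i) * a
    rw [← BimodEnd.evalAt_rho_lmul, S.casimir, BimodEnd.evalAt_rmul]

theorem sum_coeff_rho_mul (v : Cent ι) :
    ∑ i, S.quasiBasis.coeff i (BimodEnd.rho ι v) * S.r i = v := by
  have h := congrArg (fun α : BimodEnd ι => α.1 1) (S.quasiBasis.sum_coeff_mul (BimodEnd.rho ι v))
  refine Subtype.ext ?_
  simp only [AddSubmonoidClass.coe_finsetSum, LinearMap.sum_apply] at h ⊢
  change ∑ i, (S.quasiBasis.coeff i (BimodEnd.rho ι v) : A) * (1 * S.r i) = 1 * v.1 at h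
  simp only [one_mul] at h
  exact h

variable {k : Type*} [CommRing k] [Algebra k (Cent ι)]
  (hk : ∀ c : k, (algebraMap k (Cent ι) c : A) ∈ Subalgebra.center K A)

/-- The coefficients `e_i¹ v e_i²` of `ρ_v` are central, hence scalars, and can be moved across
the tensor sign. -/
theorem invHom_envHom
    (hk' : ∀ z ∈ Subalgebra.center K A, ∃ c : k, (algebraMap k (Cent ι) c : A) = z)
    (p : Cent ι ⊗[k] (Cent ι)ᵐᵒᵖ) : S.invHom k (BimodEnd.envHom k hk p) = p := by
  induction p with
  | zero => simp only [map_zero]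
  | tmul u v =>
    obtain ⟨v, rfl⟩ := MulOpposite.op_surjective v
    choose c hc using fun i => hk' _ (S.coeff_rho_mem_center i v)
    have hc' : ∀ i, S.quasiBasis.coeff i (BimodEnd.rho ι v) = algebraMap k (Cent ι) (c i) :=
      fun i => Subtype.ext (hc i).symm
    rw [BimodEnd.envHom_tmul]
    change ∑ i, S.quasiBasis.coeff i (BimodEnd.lam ι u * BimodEnd.rho ι v) ⊗ₜ[k] op (S.r i) = _
    conv_rhs => rw [← S.sum_coeff_rho_mul v, Finset.op_sum, TensorProduct.tmul_sum]
    refine Finset.sum_congr rfl fun i _ => ?_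
    rw [LeftD2QuasiBasis.coeff_lam_mul, hc', ← Algebra.commutes, ← Algebra.smul_def,
      ← Algebra.smul_def, MulOpposite.op_smul, TensorProduct.smul_tmul]
  | add p q hp hq => simp only [map_add, hp, hq]

theorem envHom_invHom (α : BimodEnd ι) : BimodEnd.envHom k hk (S.invHom k α) = α := by
  change BimodEnd.envHom k hk (∑ i, S.quasiBasis.coeff i α ⊗ₜ[k] op (S.r i)) = α
  rw [map_sum]
  exact S.quasiBasis.sum_coeff_mul α

/-- The isomorphism `R ⊗_k R^op ≃ 𝒮` with inverse `invHom`. -/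
def envEquiv (hk' : ∀ z ∈ Subalgebra.center K A, ∃ c : k, (algebraMap k (Cent ι) c : A) = z) :
    (Cent ι ⊗[k] (Cent ι)ᵐᵒᵖ) ≃+* BimodEnd ι :=
  { BimodEnd.envHom k hk with
    invFun := S.invHom k
    left_inv := S.invHom_envHom hk hk'
    right_inv := S.envHom_invHom hk }

theorem envelopingIso (S : HSeparabilitySystem ι)
    (hk : ∀ c : k, (algebraMap k (Cent ι) c : A) ∈ Subalgebra.center K A)
    (hk' : ∀ z ∈ Subalgebra.center K A, ∃ c : k, (algebraMap k (Cent ι) c : A) = z)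
    (q : LeftD2QuasiBasis ι) : EnvelopingIso ι k q := by
  have hΨ : (envData k (Cent ι)).IsBialgebroidHom (BimodEnd.data ι q)
      (S.envEquiv hk hk' : _ →+* _) := BimodEnd.envHom_isBialgebroidHom k hk q
  have hτ := BialgebroidData.isAntipode_conj (envTwist_isAntipode k (Cent ι)) _ hΨ
  refine ⟨(envData_isSpannedByGrouplikes k (Cent ι)).isLeftBialgebroid, envTwist_isAntipode k _,
    BimodEnd.data_isLeftBialgebroid q, S.envEquiv hk hk', fun r s => rfl, hΨ, hτ⟩

end HSeparabilitySystem

/-! ### Pseudo-Galois sets of an H-separable extension -/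

theorem IsHSeparable.isPseudoGaloisSet_one (h : IsHSeparable ι) :
    IsPseudoGaloisSet ι {1} := by
  obtain ⟨N, hN, f, g, hfl, hfr, hgl, hgr, hgf⟩ := h
  have hσ : ∀ (σ : ({1} : Finset (AutB ι))) (a : A), σ.1.1 a = a := by
    rintro ⟨σ, hσ⟩ a
    obtain rfl := Finset.mem_singleton.1 hσ
    rfl
  let o : ({1} : Finset (AutB ι)) := ⟨1, Finset.mem_singleton_self 1⟩
  refine ⟨N, hN, AddMonoidHom.mk' (fun t _ => f t) fun t t' => ?_,
    g.comp (Pi.evalAddMonoidHom _ o), fun a t _ i => hfl a t i, fun a t σ i => ?_,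
    fun a v => hgl a (v o), fun a v => ?_, hgf⟩
  · ext σ i
    rw [map_add]
    rfl
  · rw [hσ]
    exact hfr a t i
  · simp only [hσ]
    exact hgr a (v o)

theorem not_isPseudoGaloisSet_empty [Nontrivial A] : ¬ IsPseudoGaloisSet ι ∅ := by
  rintro ⟨N, -, f, g, -, -, -, -, hgf⟩
  have h : TensSq.tmul ι 1 1 = 0 := by
    rw [← hgf (TensSq.tmul ι 1 1), ← map_zero g]
    congr 1
    ext σ
    exact absurd σ.2 (Finset.notMem_empty _)
  have h' := congrArg (BimodEnd.evalAt ι 1 1) h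
  rw [BimodEnd.evalAt_tmul, map_zero] at h'
  change (1 * 1 : A) * 1 = 0 at h'
  rw [mul_one, mul_one] at h'
  exact one_ne_zero h'

theorem IsHSeparable.isMinimalPseudoGaloisSet_one [Nontrivial A] (h : IsHSeparable ι) :
    IsMinimalPseudoGaloisSet ι {1} := by
  refine ⟨h.isPseudoGaloisSet_one, fun 𝒢 h𝒢 => ?_, fun σ hσ τ hτ hne => ?_⟩
  · rw [Finset.ssubset_singleton_iff.1 h𝒢]
    exact not_isPseudoGaloisSet_empty
  · exact absurd ((Finset.mem_singleton.1 hσ).trans (Finset.mem_singleton.1 hτ).symm) hne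

theorem IsHSeparable.eq_one_of_isMinimalPseudoGaloisSet (h : IsHSeparable ι)
    {𝒢 : Finset (AutB ι)} (h𝒢 : IsMinimalPseudoGaloisSet ι 𝒢) (h1 : 1 ∈ 𝒢) : 𝒢 = {1} := by
  by_contra hne
  exact h𝒢.2.1 {1} ((Finset.singleton_subset_iff.2 h1).ssubset_of_ne (Ne.symm hne))
    h.isPseudoGaloisSet_one

end Extensions

/-! ### Galois extensions -/

section Extensions

variable {K A B : Type*} [CommRing K] [Ring A] [Algebra K A] [Ring B] [Algebra K B]
  {ι : B →ₐ[K] A}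

namespace BimodEnd

variable (ι) (G : Subgroup (AutB ι))

/-- The additive map underlying `bowtieHom`. -/
def bowtieAddHom : Bowtie K (Cent ι) G →+ BimodEnd ι :=
  Bowtie.lift (K := K) (R := Cent ι) (G := G) (P := BimodEnd ι) fun σ => TensorProduct.liftAddHom
    ((AddMonoidHom.mul.comp ((AddMonoidHom.mulRight (aut ι σ.1)).comp
      (sourceTarget ι).source.toAddMonoidHom)).compl₂ (sourceTarget ι).target.toAddMonoidHom)
    fun (c : K) r s => by
      change lam ι (c • r) * aut ι σ.1 * rho ι (unop s) =
        lam ι r * aut ι σ.1 * rho ι (unop (c • s))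
      ext x
      change (c • r.1) * σ.1.1 (x * (unop s).1) = r.1 * σ.1.1 (x * (c • (unop s).1))
      rw [mul_smul_comm, map_smul, mul_smul_comm, smul_mul_assoc]

theorem bowtieAddHom_mk (σ : G) (r s : Cent ι) :
    bowtieAddHom ι G (Bowtie.mk σ (r ⊗ₜ[K] op s)) = lam ι r * aut ι σ.1 * rho ι s := by
  rw [bowtieAddHom, Bowtie.lift_mk]
  rfl

/-- The ring homomorphism `r ⊗ s̄ ⋈ σ ↦ λ_r ∘ σ ∘ ρ_s` on `R^e ⋈ G`. -/
def bowtieHom : Bowtie K (Cent ι) G →+* BimodEnd ι :=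
  let ψ : Bowtie K (Cent ι) G →+ BimodEnd ι := bowtieAddHom ι G
  have hψ : ∀ (σ : G) (r s : Cent ι), ψ (Bowtie.mk σ (r ⊗ₜ[K] op s)) =
    lam ι r * aut ι σ.1 * rho ι s := bowtieAddHom_mk ι G
  { ψ with
    map_one' := by
      change ψ (Bowtie.mk 1 (1 ⊗ₜ[K] op 1)) = 1
      rw [hψ]
      ext x
      change (1 : A) * (x * 1) = x
      rw [one_mul, mul_one]
    map_mul' := by
      intro x x'
      change ψ (x * x') = ψ x * ψ x'
      induction x using Bowtie.induction_on with
      | zero => rw [zero_mul, map_zero, zero_mul]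
      | mk σ r s =>
        induction x' using Bowtie.induction_on with
        | zero => rw [mul_zero, map_zero, mul_zero]
        | mk τ u v =>
          rw [Bowtie.mk_tmul_mul_mk_tmul, hψ, hψ, hψ]
          ext x
          change r.1 * σ.1.1 u.1 * σ.1.1 (τ.1.1 (x * (v.1 * (τ⁻¹ • s : Cent ι).1))) =
            r.1 * σ.1.1 (u.1 * τ.1.1 (x * v.1) * s.1)
          have hs : τ.1.1 (τ⁻¹ • s : Cent ι).1 = s.1 :=
            congrArg Subtype.val (smul_inv_smul τ s)
          simp only [map_mul, hs, mul_assoc]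
        | add y z hy hz => rw [mul_add, map_add, hy, hz, map_add, mul_add]
      | add y z hy hz => rw [add_mul, map_add, hy, hz, map_add, add_mul] }

theorem bowtieHom_mk (σ : G) (r s : Cent ι) :
    bowtieHom ι G (Bowtie.mk σ (r ⊗ₜ[K] op s)) = lam ι r * aut ι σ.1 * rho ι s :=
  bowtieAddHom_mk ι G σ r s

theorem bowtieHom_mk_tmul_one (σ : G) (r : Cent ι) :
    bowtieHom ι G (Bowtie.mk σ (r ⊗ₜ[K] 1)) = lam ι r * aut ι σ.1 := by
  rw [← MulOpposite.op_one, bowtieHom_mk]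
  ext x
  change r.1 * σ.1.1 (x * 1) = r.1 * σ.1.1 x
  rw [mul_one]

theorem bowtieHom_isBialgebroidHom (q : LeftD2QuasiBasis ι) :
    (Bowtie.data K (Cent ι) G).IsBialgebroidHom (data ι q) (bowtieHom ι G) := by
  have h1 : ∀ σ : G, bowtieHom ι G (Bowtie.mk σ 1) = aut ι σ.1 := fun σ => by
    rw [Algebra.TensorProduct.one_def, bowtieHom_mk_tmul_one]
    ext x
    exact one_mul _
  refine isBialgebroidHom_of_grouplikes q (Bowtie.data_isSpannedByGrouplikes K (Cent ι) G) _
    (fun r => ?_) (fun r => ?_) (fun σ => ?_) (fun σ x y => ?_)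
  · exact bowtieHom_mk_tmul_one ι G 1 r
  · refine (bowtieHom_mk ι G 1 1 r).trans ?_
    ext x
    exact one_mul _
  · rw [h1]
    exact map_one σ.1.1
  · rw [h1]
    exact map_mul σ.1.1 x y

/-- The ring homomorphism `r σ ↦ λ_r ∘ σ` on the skew group ring `R ⋊ G`. -/
def skewHom : SkewMonoidAlgebra (Cent ι) G →+* BimodEnd ι :=
  SkewMonoidAlgebra.liftNCRingHom (sourceTarget ι).source
    { toFun := fun σ : G => aut ι σ.1
      map_one' := rfl
      map_mul' := fun _ _ => rfl } fun {r σ} => by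
    ext x
    exact (map_mul σ.1.1 r.1 x).symm

theorem skewHom_single (σ : G) (r : Cent ι) :
    skewHom ι G (SkewMonoidAlgebra.single σ r) = lam ι r * aut ι σ.1 :=
  SkewMonoidAlgebra.liftNC_single _ _ _ _

/-- The embedding `r σ ↦ r ⊗ 1 ⋈ σ` of `R ⋊ G` into `R^e ⋈ G`. -/
def skewToBowtie : SkewMonoidAlgebra (Cent ι) G →+* Bowtie K (Cent ι) G :=
  SkewMonoidAlgebra.liftNCRingHom (Bowtie.data K (Cent ι) G).source
    { toFun := fun σ : G => Bowtie.mk σ 1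
      map_one' := rfl
      map_mul' := (Bowtie.data_isSpannedByGrouplikes K (Cent ι) G).grouplike_mul } fun {r σ} =>
    ((Bowtie.data_isSpannedByGrouplikes K (Cent ι) G).mul_source σ r).symm

theorem skewToBowtie_single (σ : G) (r : Cent ι) :
    skewToBowtie ι G (SkewMonoidAlgebra.single σ r) = Bowtie.mk σ (r ⊗ₜ[K] 1) := by
  have h := Bowtie.source_mul_target_mul_mk (K := K) r 1 σ
  rw [smul_one, MulOpposite.op_one, map_one, mul_one] at h
  exact (SkewMonoidAlgebra.liftNC_single _ _ _ _).trans h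

theorem bowtieHom_skewToBowtie (x : SkewMonoidAlgebra (Cent ι) G) :
    bowtieHom ι G (skewToBowtie ι G x) = skewHom ι G x := by
  induction x using SkewMonoidAlgebra.induction_on with
  | zero => simp only [map_zero]
  | single σ r => rw [skewToBowtie_single, bowtieHom_mk_tmul_one, skewHom_single]
  | add x y hx hy => simp only [map_add, hx, hy]

end BimodEnd

namespace IsGaloisCoordinates

variable {G : Subgroup (AutB ι)} {n : ℕ} {a b : Fin n → A}

/-- The defining relations of Galois coordinates, translated by `τ`. -/
theorem sum_apply_mul_apply (h : IsGaloisCoordinates ι G a b) [DecidableEq G] (τ σ : G) :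
    ∑ i, τ.1.1 (a i) * σ.1.1 (b i) = if τ = σ then 1 else 0 := by
  have e : ∑ i, τ.1.1 (a i) * σ.1.1 (b i) = τ.1.1 (∑ i, a i * (τ⁻¹ * σ).1.1 (b i)) := by
    rw [map_sum]
    refine Finset.sum_congr rfl fun i _ => ?_
    have hσ : τ.1.1 ((τ⁻¹ * σ).1.1 (b i)) = σ.1.1 (b i) :=
      congrArg (fun ρ : G => ρ.1.1 (b i)) (mul_inv_cancel_left τ σ)
    rw [map_mul, hσ]
  rw [e]
  split_ifs with hτ
  · subst hτ
    rw [inv_mul_cancel]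
    exact (congrArg τ.1.1 h.1).trans (map_one _)
  · rw [h.2 _ (τ⁻¹ * σ).2 fun h1 => hτ (inv_mul_eq_one.1 (Subtype.ext h1)), map_zero]

variable (ι a b) in
/-- The tensor `t_σ = ∑ i, a_i ⊗ σ(b_i)`. -/
def tensor (σ : AutB ι) : TensSq ι := ∑ i, TensSq.tmul ι (a i) (σ.1 (b i))

/-- As `x = ∑ j, a_j ∑ τ, τ(b_j x)` and the traces `∑ τ, τ(b_j x)` lie in `B`, they can be moved
across the tensor sign in `x ⊗ y`. -/
theorem sum_rmul_tensor [Fintype G] (h : IsGaloisCoordinates ι G a b)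
    (hG : ∀ x : A, (∀ σ ∈ G, σ.1 x = x) → x ∈ ι.range)
    (x y : A) :
    ∑ σ : G, TensSq.rmul ι (σ.1.1 x * y) (tensor ι a b σ.1) = TensSq.tmul ι x y := by
  classical
  have htr : ∀ z : A, ∑ σ : G, σ.1.1 z ∈ ι.range := fun z => hG _ fun τ hτ => by
    rw [map_sum]
    exact Fintype.sum_equiv (Equiv.mulLeft (⟨τ, hτ⟩ : G)) _ _ fun σ => rfl
  choose t ht using fun i => htr (b i * x)
  have hx : ∑ i, a i * ι (t i) = x := by
    have e : ∀ i, a i * ι (t i) = ∑ σ : G, a i * σ.1.1 (b i) * σ.1.1 x := fun i => by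
      have hti : ι (t i) = ∑ σ : G, σ.1.1 (b i * x) := ht i
      rw [hti, Finset.mul_sum]
      exact Finset.sum_congr rfl fun σ _ => by rw [map_mul, mul_assoc]
    rw [Finset.sum_congr rfl fun i _ => e i, Finset.sum_comm]
    have e' : ∀ σ : G, ∑ i, a i * σ.1.1 (b i) * σ.1.1 x =
        if 1 = σ then σ.1.1 x else 0 := fun σ => by
      rw [← Finset.sum_mul]
      have h1 : ∑ i, a i * σ.1.1 (b i) = if 1 = σ then 1 else 0 := h.sum_apply_mul_apply 1 σ
      rw [h1, ite_mul, one_mul, zero_mul]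
    rw [Finset.sum_congr rfl fun σ _ => e' σ, Finset.sum_ite_eq, if_pos (Finset.mem_univ _)]
    rfl
  have hxy : TensSq.tmul ι x y = ∑ i, TensSq.tmul ι (a i) (ι (t i) * y) := by
    conv_lhs => rw [← hx, TensSq.tmul, map_sum, AddMonoidHom.finsetSum_apply]
    exact Finset.sum_congr rfl fun i _ => TensSq.tmul_mul_range _ _ _
  rw [hxy]
  simp only [tensor, map_sum, TensSq.rmul_tmul]
  rw [Finset.sum_comm]
  refine Finset.sum_congr rfl fun i _ => ?_
  have hti : ι (t i) = ∑ σ : G, σ.1.1 (b i * x) := ht i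
  rw [hti, Finset.sum_mul, TensSq.tmul, map_sum]
  refine Finset.sum_congr rfl fun σ _ => ?_
  rw [map_mul σ.1.1, mul_assoc]

theorem lmul_tensor [Fintype G] (h : IsGaloisCoordinates ι G a b)
    (hG : ∀ x : A, (∀ σ ∈ G, σ.1 x = x) → x ∈ ι.range)
    (σ : G) (x : A) :
    TensSq.lmul ι x (tensor ι a b σ.1) = TensSq.rmul ι (σ.1.1 x) (tensor ι a b σ.1) := by
  classical
  have e : TensSq.lmul ι x (tensor ι a b σ.1) = ∑ i, ∑ τ : G,
      TensSq.rmulHom (tensor ι a b τ.1) (τ.1.1 x * (τ.1.1 (a i) * σ.1.1 (b i))) := by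
    conv_lhs => rw [tensor, map_sum]
    refine Finset.sum_congr rfl fun i _ => ?_
    rw [TensSq.lmul_tmul, ← h.sum_rmul_tensor hG]
    refine Finset.sum_congr rfl fun τ _ => ?_
    rw [map_mul, mul_assoc]
    rfl
  rw [e, Finset.sum_comm]
  simp only [← map_sum, ← Finset.mul_sum, h.sum_apply_mul_apply, mul_ite, mul_one, mul_zero]
  rw [Finset.sum_eq_single_of_mem σ (Finset.mem_univ σ) fun τ _ hτ => by
    rw [if_neg hτ, map_zero], if_pos rfl]
  rfl

theorem tensor_central [Fintype G] (h : IsGaloisCoordinates ι G a b)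
    (hG : ∀ x : A, (∀ σ ∈ G, σ.1 x = x) → x ∈ ι.range)
    (σ : G) (c : B) :
    TensSq.lmul ι (ι c) (tensor ι a b σ.1) = TensSq.rmul ι (ι c) (tensor ι a b σ.1) := by
  rw [h.lmul_tensor hG σ, σ.1.2]

/-- The elements of `G` and the tensors `t_σ` form a quasibasis. -/
def quasiBasis [Fintype G] (h : IsGaloisCoordinates ι G a b)
    (hG : ∀ x : A, (∀ σ ∈ G, σ.1 x = x) → x ∈ ι.range) :
    LeftD2QuasiBasis ι where
  n := Fintype.card G
  β i := BimodEnd.aut ι ((Fintype.equivFin G).symm i).1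
  t i := tensor ι a b ((Fintype.equivFin G).symm i).1
  central i c := h.tensor_central hG _ c
  sum_eq x y := by
    rw [← h.sum_rmul_tensor hG x y]
    exact Fintype.sum_equiv (Fintype.equivFin G).symm _ _ fun i => rfl

/-- The coefficient `∑ i, α(a_i) σ(b_i) ∈ R` of `α ∈ 𝒮` at `σ`. -/
def coeff [Fintype G] (h : IsGaloisCoordinates ι G a b)
    (hG : ∀ x : A, (∀ σ ∈ G, σ.1 x = x) → x ∈ ι.range)
    (σ : G) (α : BimodEnd ι) : Cent ι :=
  ⟨BimodEnd.evalAt ι α 1 (tensor ι a b σ.1),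
    BimodEnd.evalAt_one_mem_cent ι α (h.tensor_central hG σ)⟩

theorem coe_coeff [Fintype G] (h : IsGaloisCoordinates ι G a b)
    (hG : ∀ x : A, (∀ σ ∈ G, σ.1 x = x) → x ∈ ι.range)
    (σ : G) (α : BimodEnd ι) :
    (h.coeff hG σ α : A) = ∑ i, α.1 (a i) * σ.1.1 (b i) := by
  change BimodEnd.evalAt ι α 1 (∑ i, TensSq.tmul ι (a i) (σ.1.1 (b i))) = _
  rw [map_sum]
  exact Finset.sum_congr rfl fun i _ => by rw [BimodEnd.evalAt_tmul, one_mul]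

theorem sum_coeff_mul_aut [Fintype G] (h : IsGaloisCoordinates ι G a b)
    (hG : ∀ x : A, (∀ σ ∈ G, σ.1 x = x) → x ∈ ι.range)
    (α : BimodEnd ι) :
    ∑ σ : G, BimodEnd.lam ι (h.coeff hG σ α) * BimodEnd.aut ι σ.1 = α := by
  conv_rhs => rw [← (h.quasiBasis hG).sum_coeff_mul α]
  exact Fintype.sum_equiv (Fintype.equivFin G) _
    (fun i : Fin (Fintype.card G) => BimodEnd.lam ι ((h.quasiBasis hG).coeff i α) *
      (h.quasiBasis hG).β i) fun σ => by
    simp only [quasiBasis, LeftD2QuasiBasis.coeff, coeff, AddMonoidHom.mk'_apply,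
      Equiv.symm_apply_apply]

/-- The coefficient of `∑ τ, λ_{r_τ} τ` at `σ` is `r_σ`. -/
theorem sum_skewHom_apply_mul (h : IsGaloisCoordinates ι G a b)
    (x : SkewMonoidAlgebra (Cent ι) G) (σ : G) :
    ∑ i, (BimodEnd.skewHom ι G x).1 (a i) * σ.1.1 (b i) = (x.coeff σ : Cent ι) := by
  classical
  induction x using SkewMonoidAlgebra.induction_on with
  | zero => simp
  | single τ r =>
    have e : ∀ i, (BimodEnd.skewHom ι G (SkewMonoidAlgebra.single τ r)).1 (a i) * σ.1.1 (b i) =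
        r.1 * (τ.1.1 (a i) * σ.1.1 (b i)) := fun i => by
      rw [BimodEnd.skewHom_single]
      exact mul_assoc _ _ _
    rw [Finset.sum_congr rfl fun i _ => e i, ← Finset.mul_sum, h.sum_apply_mul_apply,
      SkewMonoidAlgebra.coeff_single_apply]
    split_ifs <;> simp
  | add x y hx hy =>
    have e : ∀ i, (BimodEnd.skewHom ι G (x + y)).1 (a i) * σ.1.1 (b i) =
        (BimodEnd.skewHom ι G x).1 (a i) * σ.1.1 (b i) +
        (BimodEnd.skewHom ι G y).1 (a i) * σ.1.1 (b i) := fun i => by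
      rw [map_add, ← add_mul]
      rfl
    rw [Finset.sum_congr rfl fun i _ => e i, Finset.sum_add_distrib, hx, hy,
      SkewMonoidAlgebra.coeff_add]
    rfl

/-- The isomorphism `α ↦ ∑ σ, (∑ i, α(a_i) σ(b_i)) σ` of `𝒮` with `R ⋊ G`, as the inverse of the
ring homomorphism `skewHom`. -/
def skewEquiv [Fintype G] (h : IsGaloisCoordinates ι G a b)
    (hG : ∀ x : A, (∀ σ ∈ G, σ.1 x = x) → x ∈ ι.range) :
    BimodEnd ι ≃+* SkewMonoidAlgebra (Cent ι) G :=
  RingEquiv.symm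
    { BimodEnd.skewHom ι G with
      invFun := fun α => ⟨Finsupp.equivFunOnFinite.symm fun σ => h.coeff hG σ α⟩
      left_inv := fun x => SkewMonoidAlgebra.ext fun σ => Subtype.ext <| by
        change (h.coeff hG σ (BimodEnd.skewHom ι G x) : A) = _
        rw [coe_coeff, h.sum_skewHom_apply_mul]
      right_inv := fun α => by
        change BimodEnd.skewHom ι G ⟨Finsupp.equivFunOnFinite.symm fun σ => h.coeff hG σ α⟩ = α
        have e : (⟨Finsupp.equivFunOnFinite.symm fun σ => h.coeff hG σ α⟩ :
            SkewMonoidAlgebra (Cent ι) G) =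
            ∑ σ : G, SkewMonoidAlgebra.single σ (h.coeff hG σ α) := by
          classical
          refine SkewMonoidAlgebra.ext fun τ => ?_
          change _ = Finsupp.applyAddHom τ (SkewMonoidAlgebra.coeffAddEquiv.toAddMonoidHom _)
          rw [map_sum, map_sum]
          change h.coeff hG τ α = ∑ σ : G, (SkewMonoidAlgebra.single σ (h.coeff hG σ α)).coeff τ
          simp [Finsupp.single_apply]
        rw [e, map_sum]
        conv_rhs => rw [← h.sum_coeff_mul_aut hG α]
        exact Finset.sum_congr rfl fun σ _ => BimodEnd.skewHom_single ι G σ _ }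

theorem skewEquiv_symm_apply [Fintype G] (h : IsGaloisCoordinates ι G a b)
    (hG : ∀ x : A, (∀ σ ∈ G, σ.1 x = x) → x ∈ ι.range)
    (x : SkewMonoidAlgebra (Cent ι) G) :
    (h.skewEquiv hG).symm x = BimodEnd.skewHom ι G x := rfl

theorem skewEquiv_coeff [Fintype G] (h : IsGaloisCoordinates ι G a b)
    (hG : ∀ x : A, (∀ σ ∈ G, σ.1 x = x) → x ∈ ι.range)
    (α : BimodEnd ι) (σ : G) :
    (h.skewEquiv hG α).coeff σ = h.coeff hG σ α := rfl

end IsGaloisCoordinates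

end Extensions

end

theorem mainTheorem4 {K A B : Type*} [CommRing K] [Ring A] [Algebra K A] [Ring B] [Algebra K B]
    (ι : B →ₐ[K] A) :
    -- H-separable extensions
    (IsHSeparable ι →
      IsPseudoGaloisSet ι {1} ∧
      (Nontrivial A → IsMinimalPseudoGaloisSet ι {1}) ∧
      Subgroup.closure (({1} : Finset (AutB ι)) : Set (AutB ι)) = ⊥ ∧
      (∀ 𝒢 : Finset (AutB ι), IsMinimalPseudoGaloisSet ι 𝒢 → 1 ∈ 𝒢 →
        𝒢 = {1} ∧ Subgroup.closure (𝒢 : Set (AutB ι)) = ⊥) ∧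
      Nonempty (LeftD2QuasiBasis ι) ∧
      ∀ q : LeftD2QuasiBasis ι,
        EnvelopingIso ι (Subalgebra.center K A) q ∧
        ((∀ z ∈ Subalgebra.center K A, ∃ k : K, algebraMap K A k = z) →
          EnvelopingIso ι K q)) ∧
    -- Galois extensions
    (∀ G : Subgroup (AutB ι), IsGaloisExt ι G →
      Nonempty (LeftD2QuasiBasis ι) ∧
      ∀ q : LeftD2QuasiBasis ι,
        (Bowtie.data K (Cent ι) G).IsLeftBialgebroid ∧
        (BimodEnd.data ι q).IsLeftBialgebroid ∧
        ∃ (Ψ : Bowtie K (Cent ι) G →+* BimodEnd ι)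
          (Φ : BimodEnd ι ≃+* SkewMonoidAlgebra (Cent ι) G)
          (j : SkewMonoidAlgebra (Cent ι) G →+* Bowtie K (Cent ι) G),
          (∀ (r s : Cent ι) (σ : G), Ψ (Bowtie.mk σ (r ⊗ₜ[K] op s)) =
            BimodEnd.lam ι r * BimodEnd.aut ι σ.1 * BimodEnd.rho ι s) ∧
          (Bowtie.data K (Cent ι) G).IsBialgebroidHom (BimodEnd.data ι q) Ψ ∧
          Function.Surjective Ψ ∧
          (∀ (c : K) (α : BimodEnd ι), Φ (c • α) = c • Φ α) ∧
          (∀ (n : ℕ) (a b : Fin n → A), IsGaloisCoordinates ι G a b →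
            ∀ (α : BimodEnd ι) (σ : G),
              (((Φ α).coeff σ : Cent ι) : A) = ∑ i, α.1 (a i) * σ.1.1 (b i)) ∧
          (∀ (r : Cent ι) (σ : G), Φ.symm (SkewMonoidAlgebra.single σ r) =
            BimodEnd.lam ι r * BimodEnd.aut ι σ.1) ∧
          (∀ (r : Cent ι) (σ : G), j (SkewMonoidAlgebra.single σ r) =
            Bowtie.mk σ (r ⊗ₜ[K] 1)) ∧
          (∀ x, Φ (Ψ (j x)) = x) ∧
          ∀ α, Ψ (j (Φ α)) = α) := by
  have hbot : Subgroup.closure (({1} : Finset (AutB ι)) : Set (AutB ι)) = ⊥ := by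
    rw [Finset.coe_singleton, Subgroup.closure_singleton_one]
  refine ⟨fun h => ?_, fun G hG => ?_⟩
  · obtain ⟨S⟩ := h.nonempty_system
    refine ⟨h.isPseudoGaloisSet_one, fun _ => h.isMinimalPseudoGaloisSet_one, hbot,
      fun 𝒢 h𝒢 h1 => ?_, ⟨S.quasiBasis⟩, fun q => ⟨?_, fun hK => ?_⟩⟩
    · obtain rfl := h.eq_one_of_isMinimalPseudoGaloisSet h𝒢 h1
      exact ⟨rfl, hbot⟩
    · exact S.envelopingIso (fun c => c.2) (fun z hz => ⟨⟨z, hz⟩, rfl⟩) q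
    · exact S.envelopingIso (fun c => Subalgebra.algebraMap_mem _ c) hK q
  · obtain ⟨hfin, -, hfix, n, a, b, hab⟩ := hG
    have := Fintype.ofFinite G
    have hj : ∀ α, BimodEnd.bowtieHom ι G (BimodEnd.skewToBowtie ι G (hab.skewEquiv hfix α)) = α :=
      fun α => by
        rw [BimodEnd.bowtieHom_skewToBowtie, ← hab.skewEquiv_symm_apply hfix,
          RingEquiv.symm_apply_apply]
    refine ⟨⟨hab.quasiBasis hfix⟩, fun q =>
      ⟨(Bowtie.data_isSpannedByGrouplikes K (Cent ι) G).isLeftBialgebroid,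
      BimodEnd.data_isLeftBialgebroid q, BimodEnd.bowtieHom ι G, hab.skewEquiv hfix,
      BimodEnd.skewToBowtie ι G, fun r s σ => BimodEnd.bowtieHom_mk ι G σ r s,
      BimodEnd.bowtieHom_isBialgebroidHom ι G q, fun α => ⟨_, hj α⟩, fun c α => ?_,
      fun m a' b' hab' α σ => ?_, fun r σ => BimodEnd.skewHom_single ι G σ r,
      fun r σ => BimodEnd.skewToBowtie_single ι G σ r, fun x => ?_, hj⟩⟩
    · refine SkewMonoidAlgebra.ext fun σ => Subtype.ext ?_
      rw [SkewMonoidAlgebra.coeff_smul, hab.skewEquiv_coeff, Finsupp.smul_apply,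
        hab.skewEquiv_coeff, hab.coe_coeff]
      change _ = c • (hab.coeff hfix σ α : A)
      rw [hab.coe_coeff, Finset.smul_sum]
      exact Finset.sum_congr rfl fun i _ => smul_mul_assoc c (α.1 (a i)) _
    · rw [← hab'.sum_skewHom_apply_mul, ← hab.skewEquiv_symm_apply hfix,
        RingEquiv.symm_apply_apply]
    · rw [BimodEnd.bowtieHom_skewToBowtie, ← hab.skewEquiv_symm_apply hfix,
        RingEquiv.apply_symm_apply]
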